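/- **Machine model.** A *RAM with addition* has an accumulator $A$, a buffer $B$, work registers $R[0],R[1],\dots$, read-only input registers $I[0],I[1],\dots$ and an input size register $N$, all containing natural numbers. A program is a finite sequence $I_0,\dots,I_{r-1}$ of instructions of the following forms: $A\gets j$ (for a constant $j\in\mathbb{N}$); $B\gets A$; $R[A]\gets B$; $A\gets R[A]$; "if $A=0$ then goto $\ell_0$ else goto $\ell_1$" (with $0\le \ell_0,\ell_1\le r$); $A\gets A+B$; $A\gets N$; $A\gets I[A]$; output $A$. Execution starts at instruction $0$ with $A=B=0$ and halts on reaching index $r$. The running time is the number of instructions executed, and the output is the list of output values in order. In a computation with input size $N$, all register contents are required to be $O(N)$. **Proposition.** Let $c\ge 2$ and $d\ge 1$ be fixed integers. There is a RAM with addition, consisting of a precomputation program and a query program (which are independent of $N$), and there are constants $k,T,b\in\mathbb{N}$, such that for every integer $N>0$: 1. *Precomputation.* With $N$ in the input size register, and all work registers and input registers equal to $0$, the precomputation program halts in time at most $kN$, leaving some contents (the precomputed tables) in the work registers. 2. *Computation of the root.* For every integer $x$ with $0\le x<N^d$: with $N$ in the input size register, the tables left by the precomputation in the work registers, and the base-$N$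 digits of $x$ (least significant first) in the input registers $I[0],\dots,I[d-1]$ (the other input registers being $0$), the query program halts in time at most $T$, and its output is the list of the $d$ base-$N$ digits, least significant first, of $\lfloor x^{1/c}\rfloor$. Throughout both phases the contents of $A$, $B$ and all work registers are at most $bN$. (For $N=1$ the only integer $x<N^d$ is $0$, and all its digits are $0$.) -/

import Mathlib

namespace AdditionRAM

/-- The instructions of the RAM with addition as its only operation. `A` is the accumulator, `B` the
buffer, `R[j]` the work registers, `I[j]` the (read-only) input registers, `N` the input size
register. -/
inductive Instr : Type
  /-- `A ← j` -/
  | cst (j : ℕ)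
  /-- `B ← A` -/
  | buffer
  /-- `R[A] ← B` -/
  | store
  /-- `A ← R[A]` -/
  | load
  /-- `if A = 0 then goto ℓ₀ else goto ℓ₁` -/
  | jzero (ℓ₀ ℓ₁ : ℕ)
  /-- `A ← A + B` -/
  | add
  /-- `A ← N` -/
  | getN
  /-- `A ← I[A]` -/
  | input
  /-- output `A` -/
  | output

/-- A program is a finite sequence `I₀, …, I_{r-1}` of instructions in which every jump goes to an
index in `0, …, r`. -/
structure Program where
  code : List Instr
  jumps_le : ∀ ℓ₀ ℓ₁ : ℕ, Instr.jzero ℓ₀ ℓ₁ ∈ code → ℓ₀ ≤ code.length ∧ ℓ₁ ≤ code.length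

/-- A configuration: the contents of `A` and `B`, the index `pc` of the current instruction, the
contents `mem` of the work registers, and the list `out` of the values output so far, in the order in
which they were output. -/
structure Config where
  A : ℕ
  B : ℕ
  pc : ℕ
  mem : ℕ → ℕ
  out : List ℕ

/-- The configuration in which a program starts when the work registers contain `mem`. -/
def Config.start (mem : ℕ → ℕ) : Config where
  A := 0
  B := 0
  pc := 0
  mem := mem
  out := []

/-- All register contents are at most `b`. (Every address that is used is a content of `A`.) -/
def Config.BoundedBy (C : Config) (b : ℕ) : Prop :=
  C.A ≤ b ∧ C.B ≤ b ∧ ∀ j, C.mem j ≤ b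

/-- The effect of one instruction when the input size register contains `N` and the input registers
contain `I`. -/
def Instr.exec (N : ℕ) (I : ℕ → ℕ) (C : Config) : Instr → Config
  | .cst j => { C with A := j, pc := C.pc + 1 }
  | .buffer => { C with B := C.A, pc := C.pc + 1 }
  | .store => { C with mem := Function.update C.mem C.A C.B, pc := C.pc + 1 }
  | .load => { C with A := C.mem C.A, pc := C.pc + 1 }
  | .jzero ℓ₀ ℓ₁ => { C with pc := if C.A = 0 then ℓ₀ else ℓ₁ }
  | .add => { C with A := C.A + C.B, pc := C.pc + 1 }
  | .getN => { C with A := N, pc := C.pc + 1 }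
  | .input => { C with A := I C.A, pc := C.pc + 1 }
  | .output => { C with out := C.out ++ [C.A], pc := C.pc + 1 }

/-- One step of a program; a configuration whose index is the length of the program is final, and is
left unchanged. -/
def Program.step (P : Program) (N : ℕ) (I : ℕ → ℕ) (C : Config) : Config :=
  match P.code[C.pc]? with
  | some i => i.exec N I C
  | none => C

/-- The configuration reached from `C₀` after `s` steps. -/
def Program.configAt (P : Program) (N : ℕ) (I : ℕ → ℕ) (C₀ : Config) (s : ℕ) : Config :=
  (P.step N I)^[s] C₀

/-- From `C₀`, the program `P` halts in the final configuration `C` with running time exactly `t`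
(the number of configurations before the final one), and all register contents are at most `b`
throughout the computation. -/
def Program.RunsTo (P : Program) (N : ℕ) (I : ℕ → ℕ) (C₀ : Config) (t b : ℕ) (C : Config) : Prop :=
  P.configAt N I C₀ t = C ∧
  C.pc = P.code.length ∧
  (∀ s < t, (P.configAt N I C₀ s).pc < P.code.length) ∧
  ∀ s ≤ t, (P.configAt N I C₀ s).BoundedBy b

/-- The `i`-th digit of `x` in base `N`, starting from the least significant one. -/
def digit (N x i : ℕ) : ℕ := x / N ^ i % N

/-- The `d` lowest digits of `x` in base `N`, least significant digit first. -/
def digitList (N d x : ℕ) : List ℕ := (List.range d).map (digit N x)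

/-- Every `x < N ^ d` is represented by its `d` digits in base `N`, also when `N = 1`. -/
theorem sum_digit_mul_pow (N d x : ℕ) (hx : x < N ^ d) :
    ∑ i ∈ Finset.range d, digit N x i * N ^ i = x := by
  have key : ∀ e, ∑ i ∈ Finset.range e, digit N x i * N ^ i = x % N ^ e := by
    intro e
    induction e with
    | zero => simp [Nat.mod_one]
    | succ e ih =>
      rw [Finset.sum_range_succ, ih, pow_succ, Nat.mod_mul, digit, mul_comm (N ^ e)]
  rw [key, Nat.mod_eq_of_lt hx]

end AdditionRAM

/-! Put `m = 2 * c + 6` and let `K` be the power of two with `N < K ^ m ≤ 2 ^ m * N` found by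
repeated doubling. Arguments up to `Q = K ^ m` are `O(N)`, so a function on them with values `O(N)`
can be tabulated in linear time if each entry follows from earlier ones in constant time. Every
number that occurs in a query is below `K ^ L` with `L` depending on `c` and `d` only. It is
therefore a list of constantly many base-`K` digits, and schoolbook arithmetic on such lists, with
table lookups for carries, digit products and complements, is an expression of constant size. The
query needs no jumps: it outputs the values of `d` fixed expressions.

The root is found one base-`K` digit at a time, because the root without its last digit is the root
of `x / K ^ c` (`iroot_div_pow`). Let `y` be this known part and `t` the missing digit. If `y < K`,
then `x < K ^ (2 * c)` and the root stands in a table. Otherwise, with `Y = y * K`, the quadratic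
error of the linear approximation of `(Y + u) ^ c` is so small that `(x - Y ^ c) / (c * Y ^ (c -
1))` exceeds `t` by at most a constant (`root_digit_bounds`). This quotient is in turn known up to a
constant from the two leading digits of the divisor and the matching part of the dividend
(`quot_bounds`), which form the index into a table. The position of the leading digits and the exact
error are unknown, so all of the constantly many candidates are formed, and the right `z` is
selected by the test `z ^ c ≤ x < (z + 1) ^ c` (`Basic.rep_pick`).

The base-`N` input is converted to base `K` by Horner's rule. The output digits come from repeated
division by `N`, which uses the same scheme of candidates and tests.

To reach the machine, expressions, assignments and simple loops are compiled. Correctness of the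
code (`Expr.reach_comp`, `Runs.reach`) includes that time and register contents exceed those of the
abstract program by constant factors only. -/

namespace AdditionRAM

/-! ### Memory layout, expressions and their code -/

/-- Names of the arrays into which the work memory is divided. -/
inductive Arr : Type
  | var | ctr | small | endN | endQ | endP | div | mod | scale | pred | comp | mul | isZero
  | quot | root
  deriving DecidableEq

/-- Cell `n` of the array `a` is the register `16 * n + a.code`; the registers `16 * n` are
temporaries. -/
def Arr.code : Arr → ℕ
  | var => 1 | ctr => 2 | small => 3 | endN => 4 | endQ => 5 | endP => 6 | div => 7 | mod => 8
  | scale => 9 | pred => 10 | comp => 11 | mul => 12 | isZero => 13 | quot => 14 | root => 15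

theorem Arr.code_pos (a : Arr) : 0 < a.code := by cases a <;> decide

theorem Arr.code_lt (a : Arr) : a.code < 16 := by cases a <;> decide

theorem Arr.code_injective : Function.Injective Arr.code := by
  intro a b h
  cases a <;> cases b <;> first | rfl | exact absurd h (by decide)

/-- What an expression can refer to: input size, input registers and arrays. -/
structure Env where
  size : ℕ
  inp : ℕ → ℕ
  tab : Arr → ℕ → ℕ

/-- Expressions. -/
inductive Expr : Type
  | cst (j : ℕ)
  | size
  | inp (j : ℕ)
  | add (e f : Expr)
  | get (a : Arr) (e : Expr)

/-- The value of an expression. -/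
def Expr.eval (v : Env) : Expr → ℕ
  | cst j => j
  | size => v.size
  | inp j => v.inp j
  | add e f => e.eval v + f.eval v
  | get a e => v.tab a (e.eval v)

@[simp] theorem Expr.eval_cst (v : Env) (j : ℕ) : (Expr.cst j).eval v = j := rfl
@[simp] theorem Expr.eval_size (v : Env) : Expr.size.eval v = v.size := rfl
@[simp] theorem Expr.eval_inp (v : Env) (j : ℕ) : (Expr.inp j).eval v = v.inp j := rfl
@[simp] theorem Expr.eval_add (v : Env) (e f : Expr) :
    (Expr.add e f).eval v = e.eval v + f.eval v := rfl
@[simp] theorem Expr.eval_get (v : Env) (a : Arr) (e : Expr) :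
    (Expr.get a e).eval v = v.tab a (e.eval v) := rfl

/-- Everything in the environment is at most `M`. -/
structure Env.Bd (v : Env) (M : ℕ) : Prop where
  one_le : 1 ≤ M
  size_le : v.size ≤ M
  inp_le : ∀ j, v.inp j ≤ M
  tab_le : ∀ a n, v.tab a n ≤ M

/-- A factor by which the evaluation of an expression, with temporaries from `k` on, can enlarge
the register contents. -/
def Expr.weight : Expr → ℕ → ℕ
  | cst j, _ => j + 1
  | size, _ => 1
  | inp j, _ => j + 1
  | add e f, k => e.weight k + f.weight (k + 1) + 16 * k + 1
  | get _ e, k => 16 * e.weight k + 16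

theorem Expr.eval_le {v : Env} {M : ℕ} (h : v.Bd M) (e : Expr) (k : ℕ) :
    e.eval v ≤ e.weight k * M := by
  induction e generalizing k with
  | cst j => simp only [eval, weight]; nlinarith [h.one_le]
  | size => simpa [eval, weight] using h.size_le
  | inp j => simp only [eval, weight]; nlinarith [h.inp_le j]
  | add e f he hf =>
    simp only [eval, weight]
    have := he k
    have := hf (k + 1)
    nlinarith
  | get a e he =>
    simp only [eval, weight]
    nlinarith [h.tab_le a (e.eval v)]

/-- The address of cell `A` of the array `a`. -/
def addrCode (a : Arr) : List Instr :=
  [.buffer, .add, .buffer, .add, .buffer, .add, .buffer, .add, .buffer, .cst a.code, .add]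

/-- Code that puts the value of an expression into `A`, using the temporaries from `k` on. -/
def Expr.comp : Expr → ℕ → List Instr
  | cst j, _ => [.cst j]
  | size, _ => [.getN]
  | inp j, _ => [.cst j, .input]
  | add e f, k => e.comp k ++ ([.buffer, .cst (16 * k), .store] ++
      (f.comp (k + 1) ++ [.buffer, .cst (16 * k), .load, .add]))
  | get a e, k => e.comp k ++ (addrCode a ++ [.load])

/-! ### Code segments and execution of jump-free code -/

/-- The instructions `l` stand in the program `P` from index `p` on. -/
def Seg (P : Program) : ℕ → List Instr → Prop
  | _, [] => True
  | p, i :: l => P.code[p]? = some i ∧ Seg P (p + 1) l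

theorem seg_append {P : Program} {p : ℕ} {l l' : List Instr} :
    Seg P p (l ++ l') ↔ Seg P p l ∧ Seg P (p + l.length) l' := by
  induction l generalizing p with
  | nil => simp [Seg]
  | cons i l ih =>
    simp only [List.cons_append, Seg, ih, List.length_cons, and_assoc]
    rw [show p + 1 + l.length = p + (l.length + 1) by ring]

theorem seg_of_code_eq {P : Program} {l l' : List Instr} (h : P.code = l ++ l') :
    Seg P l.length l' := by
  induction l' generalizing l with
  | nil => trivial
  | cons i l' ih =>
    refine ⟨by simp [h], ?_⟩
    have := @ih (l ++ [i]) (by simp [h])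
    simpa using this

theorem seg_code (P : Program) : Seg P 0 P.code := seg_of_code_eq (l := []) rfl

section Reach

variable (P : Program) (N : ℕ) (I : ℕ → ℕ) (W : ℕ)

/-- `P` goes from `C` to `C'` in `t` steps, with all register contents at most `W`. -/
def Reach (C : Config) (t : ℕ) (C' : Config) : Prop :=
  P.configAt N I C t = C' ∧
  (∀ s < t, (P.configAt N I C s).pc < P.code.length) ∧
  ∀ s ≤ t, (P.configAt N I C s).BoundedBy W

variable {P N I W}

theorem configAt_add (C : Config) (s t : ℕ) :
    P.configAt N I C (s + t) = P.configAt N I (P.configAt N I C s) t := by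
  rw [Program.configAt, Program.configAt, Program.configAt, add_comm, Function.iterate_add_apply]

theorem Reach.refl {C : Config} (h : C.BoundedBy W) : Reach P N I W C 0 C :=
  ⟨rfl, fun s hs => absurd hs (by omega), fun s hs => by
    obtain rfl : s = 0 := by omega
    exact h⟩

theorem Reach.trans {C C' C'' : Config} {t t' : ℕ} (h : Reach P N I W C t C')
    (h' : Reach P N I W C' t' C'') : Reach P N I W C (t + t') C'' := by
  obtain ⟨h1, h2, h3⟩ := h
  obtain ⟨h1', h2', h3'⟩ := h'
  refine ⟨by rw [configAt_add, h1, h1'], fun s hs => ?_, fun s hs => ?_⟩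
  · rcases lt_or_ge s t with h | h
    · exact h2 s h
    · obtain ⟨u, rfl⟩ := Nat.exists_eq_add_of_le h
      rw [configAt_add, h1]
      exact h2' u (by omega)
  · rcases lt_or_ge s t with h | h
    · exact h3 s h.le
    · obtain ⟨u, rfl⟩ := Nat.exists_eq_add_of_le h
      rw [configAt_add, h1]
      exact h3' u (by omega)

theorem Reach.single {C : Config} {i : Instr} (hi : P.code[C.pc]? = some i)
    (h : C.BoundedBy W) (h' : (i.exec N I C).BoundedBy W) :
    Reach P N I W C 1 (i.exec N I C) := by
  have e : P.configAt N I C 1 = i.exec N I C := by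
    simp [Program.configAt, Program.step, hi]
  refine ⟨e, fun s hs => ?_, fun s hs => ?_⟩
  · obtain rfl : s = 0 := by omega
    exact (List.getElem?_eq_some_iff.1 hi).1
  · obtain rfl | rfl : s = 0 ∨ s = 1 := by omega
    · exact h
    · rw [e]; exact h'

theorem Reach.bounded {C C' : Config} {t : ℕ} (h : Reach P N I W C t C') : C'.BoundedBy W := by
  rw [← h.1]
  exact h.2.2 t le_rfl

variable (N I)

/-- The effect of a list of instructions without jumps. -/
def runList (C : Config) (l : List Instr) : Config := l.foldl (fun C i => i.exec N I C) C

variable (W)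

/-- `l` has no jumps, and all register contents are at most `W` while it is executed from `C`. -/
def Safe : Config → List Instr → Prop
  | C, [] => C.BoundedBy W
  | C, i :: l => C.BoundedBy W ∧ (i.exec N I C).pc = C.pc + 1 ∧ Safe (i.exec N I C) l

variable {N I W}

theorem Safe.bounded {C : Config} {l : List Instr} (h : Safe N I W C l) : C.BoundedBy W := by
  cases l with
  | nil => exact h
  | cons i l => exact h.1

theorem Safe.reach {C : Config} {l : List Instr} (hs : Seg P C.pc l) (h : Safe N I W C l) :
    Reach P N I W C l.length (runList N I C l) := by
  induction l generalizing C with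
  | nil => exact Reach.refl h
  | cons i l ih =>
    obtain ⟨h1, h2, h3⟩ := h
    have := (Reach.single hs.1 h1 h3.bounded).trans (ih (h2 ▸ hs.2) h3)
    rw [add_comm] at this
    exact this

end Reach

/-! ### Arrays in the registers; correctness of compiled expressions -/

/-- The registers hold the arrays `σ`. -/
def Holds (mem : ℕ → ℕ) (σ : Arr → ℕ → ℕ) : Prop := ∀ a n, mem (16 * n + a.code) = σ a n

theorem Holds.update_temp {mem : ℕ → ℕ} {σ : Arr → ℕ → ℕ} (h : Holds mem σ) (k x : ℕ) :
    Holds (Function.update mem (16 * k) x) σ := by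
  intro a n
  rw [Function.update_of_ne, h a n]
  have := a.code_pos
  have := a.code_lt
  omega

/-- Assignment to one cell of an array. -/
def assign (σ : Arr → ℕ → ℕ) (a : Arr) (i x : ℕ) : Arr → ℕ → ℕ :=
  Function.update σ a (Function.update (σ a) i x)

theorem assign_apply (σ : Arr → ℕ → ℕ) (a : Arr) (i x : ℕ) (a' : Arr) (i' : ℕ) :
    assign σ a i x a' i' = if a' = a ∧ i' = i then x else σ a' i' := by
  unfold assign
  by_cases ha : a' = a
  · subst ha
    by_cases hi : i' = i
    · subst hi; simp
    · simp [hi]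
  · simp [ha]

theorem Holds.update_cell {mem : ℕ → ℕ} {σ : Arr → ℕ → ℕ} (h : Holds mem σ) (a : Arr)
    (i x : ℕ) : Holds (Function.update mem (16 * i + a.code) x) (assign σ a i x) := by
  intro a' i'
  rw [assign_apply]
  have := a.code_lt
  have := a'.code_lt
  split_ifs with hc
  · rw [hc.1, hc.2, Function.update_self]
  · rw [Function.update_of_ne, h a' i']
    intro he
    have h1 : a'.code = a.code := by omega
    exact hc ⟨Arr.code_injective h1, by omega⟩

theorem update_le {mem : ℕ → ℕ} {W i x : ℕ} (h : ∀ j, mem j ≤ W) (hx : x ≤ W) (j : ℕ) :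
    Function.update mem i x j ≤ W := by
  by_cases hj : j = i
  · subst hj; simpa using hx
  · simpa [hj] using h j

/-- Four doublings multiply the index by 16. This is why the arrays are interleaved with stride 16:
no multiplication is needed for addressing. -/
theorem reach_addrCode {P : Program} {N : ℕ} {I : ℕ → ℕ} {W : ℕ} (a : Arr) (C : Config)
    (hs : Seg P C.pc (addrCode a)) (hC : C.BoundedBy W) (hW : 16 * C.A + 16 ≤ W) :
    ∃ B, Reach P N I W C (addrCode a).length
      ⟨16 * C.A + a.code, B, C.pc + (addrCode a).length, C.mem, C.out⟩ := by
  have ha := a.code_lt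
  obtain ⟨h1, h2, h3⟩ := hC
  refine ⟨16 * C.A, ?_⟩
  have := Safe.reach (N := N) (I := I) (W := W) hs (by
    simp only [addrCode, Safe, Instr.exec, Config.BoundedBy, h3, implies_true, and_true, true_and]
    omega)
  convert this using 1
  simp only [addrCode, runList, List.foldl, Instr.exec, List.length, Config.mk.injEq, and_true]
  omega

/-- The clause on the temporaries below `k` carries the induction: a sum keeps its first summand in
temporary `k` while the second is evaluated with temporaries from `k + 1` on. -/
theorem Expr.reach_comp {P : Program} {N : ℕ} {I : ℕ → ℕ} {W M : ℕ} {σ : Arr → ℕ → ℕ}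
    (hM : (Env.mk N I σ).Bd M) (e : Expr) (k : ℕ) (C : Config) (hs : Seg P C.pc (e.comp k))
    (hC : C.BoundedBy W) (hσ : Holds C.mem σ) (hW : e.weight k * M ≤ W) :
    ∃ B mem, Reach P N I W C (e.comp k).length
        ⟨e.eval ⟨N, I, σ⟩, B, C.pc + (e.comp k).length, mem, C.out⟩ ∧
      Holds mem σ ∧ ∀ i < k, mem (16 * i) = C.mem (16 * i) := by
  have h1M := hM.one_le
  induction e generalizing k C with
  | cst j =>
    refine ⟨C.B, C.mem, ?_, hσ, fun _ _ => rfl⟩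
    simp only [weight] at hW
    refine Safe.reach hs ?_
    obtain ⟨h1, h2, h3⟩ := hC
    have : j ≤ W := by nlinarith
    simp [comp, Safe, Instr.exec, Config.BoundedBy, *]
  | size =>
    refine ⟨C.B, C.mem, ?_, hσ, fun _ _ => rfl⟩
    simp only [weight] at hW
    refine Safe.reach hs ?_
    obtain ⟨h1, h2, h3⟩ := hC
    have : N ≤ M := hM.size_le
    have : N ≤ W := by omega
    simp [comp, Safe, Instr.exec, Config.BoundedBy, *]
  | inp j =>
    refine ⟨C.B, C.mem, ?_, hσ, fun _ _ => rfl⟩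
    simp only [weight] at hW
    refine Safe.reach hs ?_
    obtain ⟨h1, h2, h3⟩ := hC
    have : I j ≤ M := hM.inp_le j
    have : I j ≤ W := by nlinarith
    have : j ≤ W := by nlinarith
    simp [comp, Safe, Instr.exec, Config.BoundedBy, *]
  | add e f he hf =>
    simp only [weight] at hW
    have vale := e.eval_le hM k
    have valf := f.eval_le hM (k + 1)
    have hk : 16 * k ≤ W := by nlinarith
    have hsum : e.eval ⟨N, I, σ⟩ + f.eval ⟨N, I, σ⟩ ≤ W := by nlinarith
    rw [comp, seg_append, seg_append, seg_append] at hs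
    obtain ⟨hs1, hs2, hs3, hs4⟩ := hs
    obtain ⟨B1, m1, r1, hm1, hk1⟩ := he k C hs1 hC hσ (by nlinarith)
    have b1 := r1.bounded
    have r2 := Safe.reach (N := N) (I := I) (W := W) (C := ⟨e.eval ⟨N, I, σ⟩, B1,
      C.pc + (e.comp k).length, m1, C.out⟩) hs2 (by
        obtain ⟨h1, h2, h3⟩ := b1
        simp only [Safe, Instr.exec, Config.BoundedBy] at *
        refine ⟨⟨h1, h2, h3⟩, trivial, ⟨h1, h1, h3⟩, trivial, ⟨hk, h1, h3⟩, trivial, hk, h1, ?_⟩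
        exact update_le h3 h1)
    have b2 := r2.bounded
    simp only [runList, List.foldl, Instr.exec] at r2 b2
    obtain ⟨B3, m3, r3, hm3, hk3⟩ := hf (k + 1) _ hs3 b2 (hm1.update_temp _ _) (by nlinarith)
    have b3 := r3.bounded
    have htmp : m3 (16 * k) = e.eval ⟨N, I, σ⟩ := by
      exact (hk3 k (by omega)).trans (Function.update_self ..)
    have r4 := Safe.reach (N := N) (I := I) (W := W) hs4 (C := ⟨f.eval ⟨N, I, σ⟩, B3,
      C.pc + (e.comp k).length + [Instr.buffer, .cst (16 * k), .store].length +
        (f.comp (k + 1)).length, m3, C.out⟩) (by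
        obtain ⟨h1, h2, h3⟩ := b3
        simp only [Safe, Instr.exec, Config.BoundedBy] at *
        refine ⟨⟨h1, h2, h3⟩, trivial, ⟨h1, h1, h3⟩, trivial, ⟨hk, h1, h3⟩, trivial,
          ⟨h3 _, h1, h3⟩, trivial, ?_, h1, h3⟩
        rw [htmp]; exact hsum)
    refine ⟨f.eval ⟨N, I, σ⟩, m3, ?_, hm3, ?_⟩
    · have := r1.trans (r2.trans (r3.trans r4))
      convert this using 1
      · simp only [comp, List.length_append, List.length]
      · simp only [runList, List.foldl, Instr.exec, comp, htmp, eval, List.length_append,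
          List.length, Config.mk.injEq, and_true, true_and]
        omega
    · intro i hi
      rw [hk3 i (by omega)]
      simp only
      rw [Function.update_of_ne (by omega), hk1 i hi]
  | get a e he =>
    simp only [weight] at hW
    have vale := e.eval_le hM k
    rw [comp, seg_append, seg_append] at hs
    obtain ⟨hs1, hs2, hs3⟩ := hs
    obtain ⟨B1, m1, r1, hm1, hk1⟩ := he k C hs1 hC hσ (by nlinarith)
    obtain ⟨B2, r2⟩ := reach_addrCode (N := N) (I := I) a _ hs2 r1.bounded (by
      simp only; nlinarith)
    have r3 := Safe.reach (N := N) (I := I) (W := W) hs3 (C := ⟨16 * e.eval ⟨N, I, σ⟩ + a.code, B2,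
      C.pc + (e.comp k).length + (addrCode a).length, m1, C.out⟩) (by
        obtain ⟨h1, h2, h3⟩ := r2.bounded
        simp only [Safe, Instr.exec, Config.BoundedBy] at *
        exact ⟨⟨h1, h2, h3⟩, trivial, h3 _, h2, h3⟩)
    refine ⟨B2, m1, ?_, hm1, hk1⟩
    have := r1.trans (r2.trans r3)
    convert this using 1
    · simp only [comp, List.length_append, List.length]
    · simp only [runList, List.foldl, Instr.exec, comp, eval, hm1 a _, List.length_append,
          List.length, Config.mk.injEq, and_true, true_and]
      omega


/-! ### Assignments -/

/-- The assignment `arr[idx] := val`. -/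
structure Asg where
  arr : Arr
  idx : Expr
  val : Expr

/-- The effect of an assignment on the arrays. -/
def Asg.exec (N : ℕ) (I : ℕ → ℕ) (σ : Arr → ℕ → ℕ) (s : Asg) : Arr → ℕ → ℕ :=
  assign σ s.arr (s.idx.eval ⟨N, I, σ⟩) (s.val.eval ⟨N, I, σ⟩)

/-- The code of an assignment. -/
def Asg.code (s : Asg) : List Instr :=
  s.idx.comp 0 ++ (addrCode s.arr ++ ([.buffer, .cst (16 * 0), .store] ++
    (s.val.comp 1 ++ [.buffer, .cst (16 * 0), .load, .store])))

/-- A factor by which an assignment can enlarge the register contents. -/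
def Asg.weight (s : Asg) : ℕ := 16 * s.idx.weight 0 + 16 + s.val.weight 1

/-- These factors multiply along a loop body, which has constant length. They do not accumulate over
iterations, since `Runs` asks for the same bound `M` at each loop test. -/
theorem Asg.bd_exec {N M : ℕ} {I : ℕ → ℕ} {σ : Arr → ℕ → ℕ} (h : (Env.mk N I σ).Bd M) (s : Asg) :
    (Env.mk N I (s.exec N I σ)).Bd (s.weight * M) := by
  have h1 := h.one_le
  have hM : M ≤ s.weight * M := Nat.le_mul_of_pos_left _ (by simp [weight])
  refine ⟨h1.trans hM, h.2.trans hM, fun j => (h.3 j).trans hM, fun a n => ?_⟩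
  simp only [exec, assign_apply]
  split_ifs
  · refine (s.val.eval_le h 1).trans (Nat.mul_le_mul_right _ ?_)
    simp [weight]
  · exact (h.4 a n).trans hM

theorem Asg.reach {P : Program} {N : ℕ} {I : ℕ → ℕ} {W M : ℕ} {σ : Arr → ℕ → ℕ}
    (hM : (Env.mk N I σ).Bd M) (s : Asg) (C : Config) (hs : Seg P C.pc s.code)
    (hC : C.BoundedBy W) (hσ : Holds C.mem σ) (hW : s.weight * M ≤ W) :
    ∃ A B mem, Reach P N I W C s.code.length ⟨A, B, C.pc + s.code.length, mem, C.out⟩ ∧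
      Holds mem (s.exec N I σ) := by
  have h1M := hM.one_le
  simp only [weight] at hW
  rw [code, seg_append, seg_append, seg_append, seg_append] at hs
  obtain ⟨hs1, hs2, hs3, hs4, hs5⟩ := hs
  obtain ⟨B1, m1, r1, hm1, -⟩ := s.idx.reach_comp hM 0 C hs1 hC hσ (by nlinarith)
  have vale := s.idx.eval_le hM 0
  obtain ⟨B2, r2⟩ := reach_addrCode (N := N) (I := I) s.arr _ hs2 r1.bounded (by
    simp only; nlinarith)
  have r3 := Safe.reach (N := N) (I := I) (W := W)
    (C := ⟨16 * s.idx.eval ⟨N, I, σ⟩ + s.arr.code, B2,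
      C.pc + (s.idx.comp 0).length + (addrCode s.arr).length, m1, C.out⟩) hs3 (by
        obtain ⟨h1, h2, h3⟩ := r2.bounded
        simp only [Safe, Instr.exec, Config.BoundedBy] at *
        refine ⟨⟨h1, h2, h3⟩, trivial, ⟨h1, h1, h3⟩, trivial, ⟨by omega, h1, h3⟩, trivial,
          by omega, h1, ?_⟩
        exact update_le h3 h1)
  have b3 := r3.bounded
  simp only [runList, List.foldl, Instr.exec] at r3 b3
  obtain ⟨B4, m4, r4, hm4, hk4⟩ := s.val.reach_comp hM 1 _ hs4 b3 (hm1.update_temp _ _)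
    (by nlinarith)
  -- The target address waits in temporary 0, which the evaluation of the right-hand side, with
  -- temporaries from 1 on, leaves alone.
  have htmp : m4 (16 * 0) = 16 * s.idx.eval ⟨N, I, σ⟩ + s.arr.code := by
    rw [hk4 0 (by omega)]
    simp
  have b4 := r4.bounded
  have r5 := Safe.reach (N := N) (I := I) (W := W) hs5 (C := ⟨s.val.eval ⟨N, I, σ⟩, B4,
      C.pc + (s.idx.comp 0).length + (addrCode s.arr).length +
      [Instr.buffer, .cst (16 * 0), .store].length + (s.val.comp 1).length, m4, C.out⟩) (by
        obtain ⟨h1, h2, h3⟩ := b4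
        simp only [Safe, Instr.exec, Config.BoundedBy] at *
        refine ⟨⟨h1, h2, h3⟩, trivial, ⟨h1, h1, h3⟩, trivial, ⟨by omega, h1, h3⟩, trivial,
          ⟨h3 _, h1, h3⟩, trivial, h3 _, h1, ?_⟩
        exact update_le h3 h1)
  refine ⟨m4 (16 * 0), s.val.eval ⟨N, I, σ⟩, Function.update m4 (m4 (16 * 0)) (s.val.eval ⟨N, I, σ⟩),
    ?_, ?_⟩
  rotate_left
  · rw [htmp]
    exact hm4.update_cell _ _ _
  · have := r1.trans (r2.trans (r3.trans (r4.trans r5)))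
    convert this using 1
    · simp only [code, List.length_append, List.length]
    · simp only [runList, List.foldl, Instr.exec, code, List.length_append,
          List.length, Config.mk.injEq, and_true, true_and]
      omega

/-- The effect of a sequence of assignments. -/
def execAll (N : ℕ) (I : ℕ → ℕ) (σ : Arr → ℕ → ℕ) (l : List Asg) : Arr → ℕ → ℕ :=
  l.foldl (Asg.exec N I) σ

/-- The code of a sequence of assignments. -/
def codeAll (l : List Asg) : List Instr := l.flatMap Asg.code

/-- A factor by which a sequence of assignments can enlarge the register contents. -/
def weightAll (l : List Asg) : ℕ := (l.map Asg.weight).prod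

theorem weightAll_pos (l : List Asg) : 0 < weightAll l :=
  List.prod_pos (by simp [Asg.weight])

theorem reach_codeAll {P : Program} {N : ℕ} {I : ℕ → ℕ} {W : ℕ} (l : List Asg) {M : ℕ}
    {σ : Arr → ℕ → ℕ} (hM : (Env.mk N I σ).Bd M) (C : Config) (hs : Seg P C.pc (codeAll l))
    (hC : C.BoundedBy W) (hσ : Holds C.mem σ) (hW : weightAll l * M ≤ W) :
    ∃ A B mem, Reach P N I W C (codeAll l).length ⟨A, B, C.pc + (codeAll l).length, mem, C.out⟩ ∧
      Holds mem (execAll N I σ l) := by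
  induction l generalizing σ M C with
  | nil => exact ⟨C.A, C.B, C.mem, Reach.refl hC, hσ⟩
  | cons s l ih =>
    rw [codeAll, List.flatMap_cons, seg_append] at hs
    rw [weightAll, List.map_cons, List.prod_cons] at hW
    have hpos : 0 < (l.map Asg.weight).prod := weightAll_pos l
    obtain ⟨A1, B1, m1, r1, hm1⟩ := s.reach hM C hs.1 hC hσ (by nlinarith)
    obtain ⟨A2, B2, m2, r2, hm2⟩ := ih (s.bd_exec hM) _ hs.2 r1.bounded hm1
      (by rw [weightAll]; nlinarith)
    refine ⟨A2, B2, m2, ?_, hm2⟩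
    have := r1.trans r2
    convert this using 1
    · simp [codeAll]
    · simp [codeAll, add_assoc]

/-! ### Loops and their execution -/

/-- A statement: an assignment, or a loop whose body, a sequence of assignments, is repeated as long
as the condition is nonzero. -/
inductive Stmt : Type
  | asg (s : Asg)
  | loop (cond : Expr) (body : List Asg)

/-- The code of a statement that begins at index `p`. -/
def Stmt.code (p : ℕ) : Stmt → List Instr
  | asg s => s.code
  | loop c b => c.comp 0 ++ ([.jzero (p + ((c.comp 0).length + 1 + (codeAll b).length + 2))
      (p + (c.comp 0).length + 1)] ++ (codeAll b ++ [.cst 0, .jzero p p]))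

/-- The number of instructions of a statement. -/
def Stmt.len : Stmt → ℕ
  | asg s => s.code.length
  | loop c b => (c.comp 0).length + 1 + (codeAll b).length + 2

theorem Stmt.length_code (p : ℕ) (s : Stmt) : (s.code p).length = s.len := by
  cases s <;> simp [code, len] ; omega

/-- The code of a sequence of statements that begins at index `p`. -/
def stmtsCode : ℕ → List Stmt → List Instr
  | _, [] => []
  | p, s :: l => s.code p ++ stmtsCode (p + s.len) l

/-- A factor by which a statement can enlarge the register contents. -/
def Stmt.weight : Stmt → ℕ
  | asg s => s.weight
  | loop c b => c.weight 0 + weightAll b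

/-- The sequence of statements `l` takes `σ` to `σ'`, with `n` assignments and loop tests at the top
level; before and after each of them, the array entries are at most `M`. -/
inductive Runs (N : ℕ) (I : ℕ → ℕ) (M : ℕ) :
    List Stmt → (Arr → ℕ → ℕ) → ℕ → (Arr → ℕ → ℕ) → Prop
  | nil {σ} : (Env.mk N I σ).Bd M → Runs N I M [] σ 0 σ
  | asg {s l σ n σ'} : (Env.mk N I σ).Bd M → Runs N I M l (s.exec N I σ) n σ' →
      Runs N I M (.asg s :: l) σ (n + 1) σ'
  | finish {c b l σ n σ'} : (Env.mk N I σ).Bd M → c.eval ⟨N, I, σ⟩ = 0 → Runs N I M l σ n σ' →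
      Runs N I M (.loop c b :: l) σ (n + 1) σ'
  | next {c b l σ n σ'} : (Env.mk N I σ).Bd M → c.eval ⟨N, I, σ⟩ ≠ 0 →
      Runs N I M (.loop c b :: l) (execAll N I σ b) n σ' →
      Runs N I M (.loop c b :: l) σ (n + 1) σ'

theorem Runs.append {N : ℕ} {I : ℕ → ℕ} {M : ℕ} {l l' : List Stmt} {σ σ' σ'' : Arr → ℕ → ℕ}
    {n n' : ℕ} (h : Runs N I M l σ n σ') (h' : Runs N I M l' σ' n' σ'') :
    Runs N I M (l ++ l') σ (n + n') σ'' := by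
  induction h with
  | nil _ => simpa using h'
  | asg hb _ ih => rw [add_right_comm]; exact .asg hb (ih h')
  | finish hb hc _ ih => rw [add_right_comm]; exact .finish hb hc (ih h')
  | next hb hc _ ih => rw [add_right_comm]; exact .next hb hc (ih h')

theorem Runs.bd_right {N : ℕ} {I : ℕ → ℕ} {M : ℕ} {l : List Stmt} {σ σ' : Arr → ℕ → ℕ}
    {n : ℕ} (h : Runs N I M l σ n σ') : (Env.mk N I σ').Bd M := by
  induction h <;> assumption

/-- Each counted step executes at most the whole code of one statement, hence the factor `T`; within
a step the contents grow by at most the weight of the statement, hence `w * M`. -/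
theorem Runs.reach {P : Program} {N : ℕ} {I : ℕ → ℕ} {W M T w : ℕ} {l : List Stmt}
    {σ σ' : Arr → ℕ → ℕ} {n : ℕ} (h : Runs N I M l σ n σ') (C : Config)
    (hs : Seg P C.pc (stmtsCode C.pc l)) (hC : C.BoundedBy W) (hσ : Holds C.mem σ)
    (hT : ∀ s ∈ l, s.len ≤ T) (hw : ∀ s ∈ l, s.weight ≤ w) (hW : w * M ≤ W) :
    ∃ t A B mem, t ≤ n * T ∧
      Reach P N I W C t ⟨A, B, C.pc + (stmtsCode C.pc l).length, mem, C.out⟩ ∧ Holds mem σ' := by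
  induction h generalizing C with
  | nil _ => exact ⟨0, C.A, C.B, C.mem, by simp, Reach.refl hC, hσ⟩
  | @asg s l σ n σ' hb hr ih =>
    rw [stmtsCode, seg_append] at hs
    have hw1 := hw (.asg s) (by simp)
    have hT1 := hT (.asg s) (by simp)
    obtain ⟨A1, B1, m1, r1, hm1⟩ := s.reach hb C hs.1 hC hσ
      ((Nat.mul_le_mul_right _ hw1).trans hW)
    have hs2 := hs.2
    rw [Stmt.length_code] at hs2
    obtain ⟨t, A2, B2, m2, ht, r2, hm2⟩ := ih ⟨A1, B1, C.pc + s.code.length, m1, C.out⟩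
      hs2 r1.bounded hm1 (fun s' h' => hT s' (by simp [h'])) (fun s' h' => hw s' (by simp [h']))
    refine ⟨s.code.length + t, A2, B2, m2, ?_, ?_, hm2⟩
    rotate_left
    · have := r1.trans r2
      convert this using 1
      simp [stmtsCode, Stmt.code, Stmt.len, add_assoc]
    · simp only [Stmt.len] at hT1
      nlinarith
  | @finish c b l σ n σ' hb hc hr ih =>
    rw [stmtsCode, seg_append] at hs
    have hw1 := hw (.loop c b) (by simp)
    have hT1 := hT (.loop c b) (by simp)
    simp only [Stmt.weight] at hw1
    obtain ⟨hs1, hs2⟩ := hs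
    rw [Stmt.length_code] at hs2
    rw [Stmt.code, seg_append, seg_append] at hs1
    obtain ⟨B1, m1, r1, hm1, -⟩ := c.reach_comp hb 0 C hs1.1 hC hσ (by nlinarith)
    have e1 : Instr.exec N I ⟨c.eval ⟨N, I, σ⟩, B1, C.pc + (c.comp 0).length, m1, C.out⟩
        (.jzero (C.pc + ((c.comp 0).length + 1 + (codeAll b).length + 2))
          (C.pc + (c.comp 0).length + 1)) =
        ⟨0, B1, C.pc + (Stmt.loop c b).len, m1, C.out⟩ := by
      simp [Instr.exec, hc, Stmt.len]
    have r2 := Reach.single (N := N) (I := I) (W := W) (C := ⟨c.eval ⟨N, I, σ⟩, B1,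
      C.pc + (c.comp 0).length, m1, C.out⟩) hs1.2.1.1 r1.bounded (by
        rw [e1]
        obtain ⟨h1, h2, h3⟩ := r1.bounded
        exact ⟨Nat.zero_le _, h2, h3⟩)
    rw [e1] at r2
    obtain ⟨t, A2, B2, m2, ht, r3, hm2⟩ := ih ⟨0, B1, C.pc + (Stmt.loop c b).len, m1, C.out⟩
      hs2 r2.bounded hm1 (fun s' h' => hT s' (by simp [h'])) (fun s' h' => hw s' (by simp [h']))
    refine ⟨(c.comp 0).length + (1 + t), A2, B2, m2, ?_, ?_, hm2⟩
    rotate_left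
    · have := r1.trans (r2.trans r3)
      convert this using 1
      simp [stmtsCode, Stmt.length_code, add_assoc]
    · simp only [Stmt.len] at hT1
      nlinarith
  | @next c b l σ n σ' hb hc hr ih =>
    have hs0 := hs
    rw [stmtsCode, seg_append] at hs
    have hw1 := hw (.loop c b) (by simp)
    have hT1 := hT (.loop c b) (by simp)
    simp only [Stmt.weight] at hw1
    obtain ⟨hs1, -⟩ := hs
    rw [Stmt.code, seg_append, seg_append, seg_append] at hs1
    obtain ⟨hsa, hsb, hsc, hsd⟩ := hs1
    obtain ⟨B1, m1, r1, hm1, -⟩ := c.reach_comp hb 0 C hsa hC hσ (by nlinarith)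
    have e1 : Instr.exec N I ⟨c.eval ⟨N, I, σ⟩, B1, C.pc + (c.comp 0).length, m1, C.out⟩
        (.jzero (C.pc + ((c.comp 0).length + 1 + (codeAll b).length + 2))
          (C.pc + (c.comp 0).length + 1)) =
        ⟨c.eval ⟨N, I, σ⟩, B1, C.pc + (c.comp 0).length + 1, m1, C.out⟩ := by
      simp [Instr.exec, hc]
    have r2 := Reach.single (N := N) (I := I) (W := W) (C := ⟨c.eval ⟨N, I, σ⟩, B1,
      C.pc + (c.comp 0).length, m1, C.out⟩) hsb.1 r1.bounded (by
        rw [e1]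
        exact r1.bounded)
    rw [e1] at r2
    obtain ⟨A3, B3, m3, r3, hm3⟩ := reach_codeAll b hb _ hsc r2.bounded hm1 (by nlinarith)
    have b3 := r3.bounded
    have b4 : Config.BoundedBy ⟨0, B3, C.pc + (c.comp 0).length + 1 + (codeAll b).length + 1, m3,
        C.out⟩ W := ⟨Nat.zero_le _, b3.2.1, b3.2.2⟩
    have b5 : Config.BoundedBy ⟨0, B3, C.pc, m3, C.out⟩ W := b4
    have r4 := Reach.single (N := N) (I := I) (W := W) (C := ⟨A3, B3, _, m3, C.out⟩) hsd.1 b3 b4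
    -- The jump back is unconditional, as both of its targets are the start of the loop.
    have e5 : Instr.exec N I ⟨0, B3, C.pc + (c.comp 0).length + 1 + (codeAll b).length + 1, m3,
        C.out⟩ (.jzero C.pc C.pc) = ⟨0, B3, C.pc, m3, C.out⟩ := by
      simp [Instr.exec]
    have r5 := Reach.single (N := N) (I := I) (W := W) hsd.2.1 b4 (e5 ▸ b5)
    obtain ⟨t, A6, B6, m6, ht, r6, hm6⟩ := ih ⟨0, B3, C.pc, m3, C.out⟩
      hs0 b5 hm3 hT hw
    refine ⟨(c.comp 0).length + (1 + ((codeAll b).length + (1 + (1 + t)))), A6, B6, m6, ?_, ?_, hm6⟩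
    rotate_left
    · exact r1.trans (r2.trans (r3.trans (r4.trans ((e5 ▸ r5).trans r6))))
    · simp only [Stmt.len] at hT1
      nlinarith


/-! ### The precomputation and query programs -/

theorem Expr.not_jzero_mem_comp (e : Expr) (k ℓ₀ ℓ₁ : ℕ) : Instr.jzero ℓ₀ ℓ₁ ∉ e.comp k := by
  induction e generalizing k <;> simp_all [comp, addrCode]

theorem not_jzero_mem_codeAll (l : List Asg) (ℓ₀ ℓ₁ : ℕ) : Instr.jzero ℓ₀ ℓ₁ ∉ codeAll l := by
  simp [codeAll, Asg.code, addrCode, Expr.not_jzero_mem_comp]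

theorem jzero_mem_stmtsCode {p : ℕ} {l : List Stmt} {ℓ₀ ℓ₁ : ℕ}
    (h : Instr.jzero ℓ₀ ℓ₁ ∈ stmtsCode p l) :
    ℓ₀ ≤ p + (stmtsCode p l).length ∧ ℓ₁ ≤ p + (stmtsCode p l).length := by
  induction l generalizing p with
  | nil => simp [stmtsCode] at h
  | cons s l ih =>
    simp only [stmtsCode, List.length_append, Stmt.length_code, List.mem_append] at h ⊢
    rcases h with h | h
    · cases s with
      | asg s => simp [Stmt.code, Asg.code, addrCode, Expr.not_jzero_mem_comp] at h
      | loop c b =>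
        simp only [Stmt.code, List.mem_append, Expr.not_jzero_mem_comp,
          not_jzero_mem_codeAll, List.mem_cons, List.not_mem_nil, reduceCtorEq, false_or,
          Instr.jzero.injEq, or_false] at h
        simp only [Stmt.len]
        omega
    · have := ih h
      omega

/-- The program that consists of the given statements. -/
def stmtsProgram (l : List Stmt) : Program where
  code := stmtsCode 0 l
  jumps_le := fun ℓ₀ ℓ₁ h => by simpa using jzero_mem_stmtsCode h

/-- Code that outputs the values of the given expressions. -/
def outCode (l : List Expr) : List Instr := l.flatMap fun e => e.comp 0 ++ [.output]

/-- The program that outputs the values of the given expressions. -/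
def outProgram (l : List Expr) : Program where
  code := outCode l
  jumps_le := fun ℓ₀ ℓ₁ h => by simp [outCode, Expr.not_jzero_mem_comp] at h

theorem reach_outCode {P : Program} {N : ℕ} {I : ℕ → ℕ} {W M : ℕ} {σ : Arr → ℕ → ℕ}
    (hM : (Env.mk N I σ).Bd M) (l : List Expr) (C : Config) (hs : Seg P C.pc (outCode l))
    (hC : C.BoundedBy W) (hσ : Holds C.mem σ) (hW : ∀ e ∈ l, e.weight 0 * M ≤ W) :
    ∃ A B mem, Reach P N I W C (outCode l).length
      ⟨A, B, C.pc + (outCode l).length, mem, C.out ++ l.map (Expr.eval ⟨N, I, σ⟩)⟩ := by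
  induction l generalizing C with
  | nil => exact ⟨C.A, C.B, C.mem, by simpa [outCode] using Reach.refl hC⟩
  | cons e l ih =>
    rw [outCode, List.flatMap_cons, seg_append, seg_append] at hs
    obtain ⟨B1, m1, r1, hm1, -⟩ := e.reach_comp hM 0 C hs.1.1 hC hσ (hW e (by simp))
    have b1 := r1.bounded
    have r2 := Reach.single (N := N) (I := I) (W := W) (i := .output) hs.1.2.1 b1 ⟨b1.1, b1.2.1, b1.2.2⟩
    simp only [Instr.exec] at r2
    have hs2 := hs.2
    rw [List.length_append, ← add_assoc] at hs2
    obtain ⟨A3, B3, m3, r3⟩ := ih _ hs2 r2.bounded hm1 fun e he => hW e (by simp [he])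
    refine ⟨A3, B3, m3, ?_⟩
    have := r1.trans (r2.trans r3)
    convert this using 1
    · simp only [outCode, List.flatMap_cons, List.length_append, List.length]
      omega
    · simp [outCode, add_assoc]
      omega

theorem Reach.runsTo {P : Program} {N : ℕ} {I : ℕ → ℕ} {W t : ℕ} {C C' : Config}
    (h : Reach P N I W C t C') (hpc : C'.pc = P.code.length) : P.RunsTo N I C t W C' :=
  ⟨h.1, hpc, h.2.1, h.2.2⟩

theorem Runs.runsTo {N : ℕ} {I : ℕ → ℕ} {M : ℕ} {l : List Stmt} {σ' : Arr → ℕ → ℕ} {n : ℕ}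
    (h : Runs N I M l (fun _ _ => 0) n σ') {T w W : ℕ} (hT : ∀ s ∈ l, s.len ≤ T)
    (hw : ∀ s ∈ l, s.weight ≤ w) (hW : w * M ≤ W) :
    ∃ t C, t ≤ n * T ∧ (stmtsProgram l).RunsTo N I (Config.start fun _ => 0) t W C ∧
      Holds C.mem σ' := by
  obtain ⟨t, A, B, mem, ht, hr, hm⟩ := h.reach (P := stmtsProgram l) (W := W)
    (Config.start fun _ => 0) (seg_code _) (by simp [Config.start, Config.BoundedBy])
    (fun _ _ => rfl) hT hw hW
  exact ⟨t, _, ht, hr.runsTo (Nat.zero_add _), hm⟩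

theorem outProgram_runsTo {N : ℕ} {I : ℕ → ℕ} {M : ℕ} {σ : Arr → ℕ → ℕ}
    (hM : (Env.mk N I σ).Bd M) (l : List Expr) {W : ℕ} {mem : ℕ → ℕ} (hmem : ∀ j, mem j ≤ W)
    (hσ : Holds mem σ) (hW : ∀ e ∈ l, e.weight 0 * M ≤ W) :
    ∃ C, (outProgram l).RunsTo N I (Config.start mem) (outCode l).length W C ∧
      C.out = l.map (Expr.eval ⟨N, I, σ⟩) := by
  obtain ⟨A, B, m, hr⟩ := reach_outCode (P := outProgram l) hM l (Config.start mem) (seg_code _)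
    ⟨Nat.zero_le _, Nat.zero_le _, hmem⟩ hσ hW
  exact ⟨_, hr.runsTo (Nat.zero_add _), by simp [Config.start]⟩


/-! ### Digits in base `K` -/

section Digits

variable {K : ℕ}

theorem digit_zero (K x : ℕ) : digit K x 0 = x % K := by simp [digit]

theorem digit_add (K x p i : ℕ) : digit K x (p + i) = digit K (x / K ^ p) i := by
  rw [digit, digit, pow_add, Nat.div_div_eq_div_mul]

theorem digit_lt (hK : 0 < K) (x i : ℕ) : digit K x i < K := Nat.mod_lt _ hK

theorem mod_pow_succ_digit (K x i : ℕ) : x % K ^ (i + 1) = x % K ^ i + digit K x i * K ^ i := by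
  rw [Nat.mod_pow_succ, digit, mul_comm]

theorem digit_eq_of_mod_eq {x y i : ℕ} (h : x % K ^ (i + 1) = y % K ^ (i + 1)) :
    digit K x i = digit K y i := by
  have key : ∀ z, digit K z i = z % K ^ (i + 1) / K ^ i := fun z => by
    rw [digit, pow_succ, Nat.mod_mul_right_div_self]
  rw [key, key, h]

theorem digit_mul_pow_of_lt (x p i : ℕ) (h : i < p) : digit K (x * K ^ p) i = 0 := by
  obtain ⟨q, rfl⟩ := Nat.exists_eq_add_of_lt h
  rcases Nat.eq_zero_or_pos K with rfl | hK
  · simp [digit]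
  rw [digit, show x * K ^ (i + q + 1) = x * K ^ q * K * K ^ i by ring,
    Nat.mul_div_cancel _ (by positivity), Nat.mul_mod_left]

end Digits

/-! ### Branch-free arithmetic of long numbers by table lookup -/

/-- The entries of the tables for arithmetic in base `K`, for arguments up to `Q`. -/
structure Basic (v : Env) (K Q : ℕ) : Prop where
  two_le : 2 ≤ K
  sq_le : K ^ 2 ≤ Q
  div : ∀ n ≤ Q, v.tab .div n = n / K
  mod : ∀ n ≤ Q, v.tab .mod n = n % K
  scale : ∀ n, n * K ≤ Q → v.tab .scale n = n * K
  pred : ∀ n ≤ Q, v.tab .pred n = n - 1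
  comp : ∀ n < K, v.tab .comp n = K - 1 - n
  mul : ∀ n ≤ Q, v.tab .mul n = n / K * (n % K)
  isZero : ∀ n ≤ 1, v.tab .isZero n = 1 - n

/-- A natural number, given by expressions for its digits. -/
abbrev Num : Type := ℕ → Expr

/-- The expressions `a i` are the digits of `x` in base `K`. -/
def Rep (v : Env) (K : ℕ) (a : Num) (x : ℕ) : Prop := ∀ i, (a i).eval v = digit K x i

/-- The carries when the digits `w i`, which may exceed the base, are normalized. -/
def carry (w : ℕ → Expr) (c : Expr) : ℕ → Expr
  | 0 => c
  | i + 1 => .get .div (.add (w i) (carry w c i))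

/-- The digits that result when the digits `w i`, which may exceed the base, are normalized. -/
def chain (w : ℕ → Expr) (c : Expr) : Num := fun i => .get .mod (.add (w i) (carry w c i))

section Circuits

variable {v : Env} {K Q : ℕ} (hB : Basic v K Q)

include hB

theorem Basic.pos : 0 < K := by have := hB.two_le; omega

theorem Basic.eval_div {e : Expr} (h : e.eval v ≤ Q) :
    (Expr.get .div e).eval v = e.eval v / K := hB.div _ h

theorem Basic.eval_mod {e : Expr} (h : e.eval v ≤ Q) :
    (Expr.get .mod e).eval v = e.eval v % K := hB.mod _ h

/-- Evaluation of carries: if `S i` is the value of the lowest `i` digits and of the initial carry,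
then the carry into position `i` is the part of `S i` from position `i` on. -/
theorem Basic.eval_carry {w : ℕ → Expr} {c : Expr} {S : ℕ → ℕ} (h0 : S 0 = c.eval v)
    (hc : c.eval v < K) (hS : ∀ i, S (i + 1) = S i + (w i).eval v * K ^ i)
    (hw : ∀ i, (w i).eval v + K ≤ K ^ 2) (i : ℕ) :
    (carry w c i).eval v = S i / K ^ i ∧ S i / K ^ i < K := by
  have hK := hB.pos
  have hQ := hB.sq_le
  induction i with
  | zero => simp [carry, h0, hc]
  | succ i ih =>
    have e : S (i + 1) / K ^ (i + 1) = ((w i).eval v + S i / K ^ i) / K := by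
      rw [hS, pow_succ, ← Nat.div_div_eq_div_mul, Nat.add_mul_div_right _ _ (by positivity),
        add_comm]
    have := hw i
    refine ⟨?_, ?_⟩
    · rw [carry, hB.eval_div (by simp only [Expr.eval_add, ih.1]; omega), e, Expr.eval_add, ih.1]
    · rw [e, Nat.div_lt_iff_lt_mul hK, ← pow_two]
      omega

/-- Digit `i` of the result depends only on `S (i + 1)` modulo `K ^ (i + 1)`. Congruence to `z`
suffices, so a surplus at the top, as in subtraction, does no harm. -/
theorem Basic.rep_chain {w : ℕ → Expr} {c : Expr} {S : ℕ → ℕ} {z : ℕ} (h0 : S 0 = c.eval v)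
    (hc : c.eval v < K) (hS : ∀ i, S (i + 1) = S i + (w i).eval v * K ^ i)
    (hw : ∀ i, (w i).eval v + K ≤ K ^ 2) (hz : ∀ i, S i % K ^ i = z % K ^ i) :
    Rep v K (chain w c) z := by
  have hK := hB.pos
  have hQ := hB.sq_le
  intro i
  obtain ⟨h1, h2⟩ := hB.eval_carry h0 hc hS hw i
  have := hw i
  rw [chain, hB.eval_mod (by simp only [Expr.eval_add, h1]; omega), Expr.eval_add, h1,
    ← digit_eq_of_mod_eq (hz (i + 1)), digit, hS, Nat.add_mul_div_right _ _ (by positivity),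
    add_comm]

omit hB in
/-- The digits of `x / K ^ p`. -/
theorem Rep.shift {a : Num} {x : ℕ} (h : Rep v K a x) (p : ℕ) :
    Rep v K (fun i => a (p + i)) (x / K ^ p) := fun i => by
  rw [h, digit_add]

/-- The sum of two numbers. -/
def Num.add (a b : Num) : Num := chain (fun i => .add (a i) (b i)) (.cst 0)

theorem Basic.rep_add {a b : Num} {x y : ℕ} (ha : Rep v K a x) (hb : Rep v K b y) :
    Rep v K (a.add b) (x + y) := by
  have hK := hB.two_le
  refine hB.rep_chain (S := fun i => x % K ^ i + y % K ^ i) (by simp [Nat.mod_one])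
    (by simp; omega) (fun i => ?_) (fun i => ?_) (fun i => (Nat.add_mod x y _).symm)
  · simp only [mod_pow_succ_digit, Expr.eval_add, ha i, hb i]
    ring
  · simp only [Expr.eval_add, ha i, hb i]
    have := digit_lt hB.pos x i
    have := digit_lt hB.pos y i
    nlinarith

/-- The product of two digits. -/
def mulExpr (e f : Expr) : Expr := .get .mul (.add (.get .scale e) f)

/-- A pair of digits is coded as the two-digit number `e * K + f`, which is below `K ^ 2 ≤ Q` and
thus a legal table index. -/
theorem Basic.eval_mulExpr {e f : Expr} (he : e.eval v < K) (hf : f.eval v < K) :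
    (mulExpr e f).eval v = e.eval v * f.eval v := by
  have hQ := hB.sq_le
  have hK := hB.pos
  have h : e.eval v * K + f.eval v < K ^ 2 := by nlinarith
  simp only [mulExpr, Expr.eval_get, Expr.eval_add]
  rw [hB.scale _ (by nlinarith), hB.mul _ (by omega), mul_comm (e.eval v) K,
    Nat.mul_add_div hK, Nat.mul_add_mod, Nat.mod_eq_of_lt hf, Nat.div_eq_of_lt hf, add_zero]

/-- The product of a digit and a number. -/
def Num.mulDigit (e : Expr) (a : Num) : Num := chain (fun i => mulExpr e (a i)) (.cst 0)

theorem Basic.rep_mulDigit {e : Expr} {a : Num} {x : ℕ} (he : e.eval v < K) (ha : Rep v K a x) :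
    Rep v K (a.mulDigit e) (e.eval v * x) := by
  have hK := hB.two_le
  have hw : ∀ i, (mulExpr e (a i)).eval v = e.eval v * digit K x i := fun i => by
    rw [hB.eval_mulExpr he (by rw [ha i]; exact digit_lt hB.pos x i), ha i]
  refine hB.rep_chain (S := fun i => e.eval v * (x % K ^ i)) (by simp [Nat.mod_one])
    (by simp; omega) (fun i => ?_) (fun i => ?_) (fun i => Nat.mul_mod_mod _ _ _)
  · simp only [mod_pow_succ_digit, hw i]
    ring
  · rw [hw i]
    have := digit_lt hB.pos x i
    obtain ⟨k, rfl⟩ := Nat.exists_eq_add_of_le hK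
    have : e.eval v * digit (2 + k) x i ≤ (1 + k) * (1 + k) :=
      Nat.mul_le_mul (by omega) (by omega)
    nlinarith

/-- `x * K ^ p` for a number `x` -/
def Num.shl (p : ℕ) (a : Num) : Num := fun i => if i < p then .cst 0 else a (i - p)

theorem Basic.rep_shl {a : Num} {x : ℕ} (ha : Rep v K a x) (p : ℕ) :
    Rep v K (a.shl p) (x * K ^ p) := by
  intro i
  unfold Num.shl
  split_ifs with h
  · rw [digit_mul_pow_of_lt _ _ _ h]; rfl
  · obtain ⟨j, rfl⟩ := Nat.exists_eq_add_of_le (not_lt.1 h)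
    rw [Nat.add_sub_cancel_left, ha, digit_add, Nat.mul_div_cancel _ (pow_pos hB.pos p)]

/-- The number zero. -/
def Num.zero : Num := fun _ => .cst 0

omit hB in
theorem rep_zero : Rep v K Num.zero 0 := fun i => by simp [Num.zero, digit]

/-- The product of two numbers, the second of which has at most `L` digits. -/
def Num.mul (a b : Num) : ℕ → Num
  | 0 => Num.zero
  | L + 1 => (Num.mul a b L).add ((a.mulDigit (b L)).shl L)

theorem Basic.rep_mul_mod {a b : Num} {x y : ℕ} (ha : Rep v K a x) (hb : Rep v K b y) (L : ℕ) :
    Rep v K (a.mul b L) (x * (y % K ^ L)) := by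
  induction L with
  | zero => simpa [Num.mul, Nat.mod_one] using rep_zero
  | succ L ih =>
    have hd : (b L).eval v < K := by rw [hb L]; exact digit_lt hB.pos y L
    have := hB.rep_add ih (hB.rep_shl (hB.rep_mulDigit hd ha) L)
    rw [mod_pow_succ_digit]
    refine (congrArg (Rep v K _) ?_).mp this
    rw [hb L]
    ring

theorem Basic.rep_mul {a b : Num} {x y : ℕ} (ha : Rep v K a x) (hb : Rep v K b y) {L : ℕ}
    (hL : y < K ^ L) : Rep v K (a.mul b L) (x * y) := by
  simpa [Nat.mod_eq_of_lt hL] using hB.rep_mul_mod ha hb L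

/-- The number that is the value of an expression. -/
def Num.ofExpr (e : Expr) : Num := fun i => .get .mod ((Expr.get .div)^[i] e)

theorem Basic.eval_iterate_div {e : Expr} (he : e.eval v ≤ Q) (i : ℕ) :
    ((Expr.get .div)^[i] e).eval v = e.eval v / K ^ i := by
  induction i with
  | zero => simp
  | succ i ih =>
    rw [Function.iterate_succ_apply', hB.eval_div (by rw [ih]; exact (Nat.div_le_self _ _).trans he),
      ih, Nat.div_div_eq_div_mul, pow_succ]

theorem Basic.rep_ofExpr {e : Expr} (he : e.eval v ≤ Q) :
    Rep v K (Num.ofExpr e) (e.eval v) := fun i => by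
  have h := hB.eval_iterate_div he i
  rw [Num.ofExpr, hB.eval_mod (by rw [h]; exact (Nat.div_le_self _ _).trans he), h, digit]

/-- The power of a number, all powers having at most `L` digits. -/
def Num.pow (L : ℕ) (a : Num) : ℕ → Num
  | 0 => Num.ofExpr (.cst 1)
  | n + 1 => (Num.pow L a n).mul a L

theorem Basic.rep_pow {a : Num} {x L : ℕ} (ha : Rep v K a x) (hL : x < K ^ L) (n : ℕ) :
    Rep v K (a.pow L n) (x ^ n) := by
  induction n with
  | zero =>
    have h1 : (Expr.cst 1).eval v ≤ Q := by
      have := hB.sq_le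
      have := hB.two_le
      simp only [Expr.eval_cst]
      nlinarith
    simpa [Num.pow] using hB.rep_ofExpr h1
  | succ n ih =>
    rw [pow_succ]
    exact hB.rep_mul ih ha hL

/-- The digit complementary to a digit. -/
def compl (e : Expr) : Expr := .get .comp e

/-- `1` if the lowest `L` digits of `b` form a number that is at most that for `a`, otherwise
`0`. -/
def Num.le (b a : Num) (L : ℕ) : Expr := carry (fun i => .add (a i) (compl (b i))) (.cst 1) L

/-- The difference `a - b` of two numbers, where `b ≤ a`. -/
def Num.sub (a b : Num) : Num := chain (fun i => .add (a i) (compl (b i))) (.cst 1)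

/-- Subtraction as addition of the complement: `K ^ i - y % K ^ i` is 1 plus the number formed by
the `i` lowest complementary digits of `y`, so the initial carry is 1. -/
theorem Basic.sub_aux {a b : Num} {x y : ℕ} (ha : Rep v K a x) (hb : Rep v K b y) :
    (∀ i, x % K ^ (i + 1) + K ^ (i + 1) - y % K ^ (i + 1) = x % K ^ i + K ^ i - y % K ^ i +
      (Expr.add (a i) (compl (b i))).eval v * K ^ i) ∧
    ∀ i, (Expr.add (a i) (compl (b i))).eval v + K ≤ K ^ 2 := by
  have hK := hB.two_le
  have hw : ∀ i, (Expr.add (a i) (compl (b i))).eval v =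
      digit K x i + (K - 1 - digit K y i) := fun i => by
    simp only [Expr.eval_add, compl, Expr.eval_get]
    rw [hB.comp _ (by rw [hb i]; exact digit_lt hB.pos y i), ha i, hb i]
  refine ⟨fun i => ?_, fun i => ?_⟩
  · have h1 := Nat.mod_lt y (pow_pos hB.pos i)
    have h2 := digit_lt hB.pos y i
    rw [hw, mod_pow_succ_digit, mod_pow_succ_digit]
    obtain ⟨e, he⟩ := Nat.exists_eq_add_of_lt h2
    rw [show K - 1 - digit K y i = e by omega, pow_succ]
    have : K ^ i * K = K ^ i * digit K y i + K ^ i * e + K ^ i := by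
      rw [← mul_add, ← mul_add_one, ← he]
    rw [this, add_mul, mul_comm (digit K y i), mul_comm e]
    generalize x % K ^ i = A, y % K ^ i = B at *
    omega
  · rw [hw]
    have := digit_lt hB.pos x i
    have : digit K x i + (K - 1 - digit K y i) ≤ 2 * K - 2 := by omega
    obtain ⟨k, rfl⟩ := Nat.exists_eq_add_of_le hK
    have : (2 + k) ^ 2 = 4 + 4 * k + k * k := by ring
    have : k ≤ k * k + 0 := by nlinarith [Nat.le_mul_self k]
    omega

/-- The carry out of `L` positions is `(x + K ^ L - y) / K ^ L`, which is 1 or 0 according to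
whether `y ≤ x`. -/
theorem Basic.eval_le {a b : Num} {x y L : ℕ} (ha : Rep v K a x) (hb : Rep v K b y)
    (hx : x < K ^ L) (hy : y < K ^ L) : (b.le a L).eval v = if y ≤ x then 1 else 0 := by
  have hK := hB.two_le
  obtain ⟨h1, h2⟩ := hB.sub_aux ha hb
  have := (hB.eval_carry (w := fun i => .add (a i) (compl (b i))) (c := .cst 1)
    (S := fun i => x % K ^ i + K ^ i - y % K ^ i)
    (by simp [Nat.mod_one]) (by simp; omega) h1 h2 L).1
  rw [Num.le, this, Nat.mod_eq_of_lt hx, Nat.mod_eq_of_lt hy]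
  split_ifs with h
  · rw [Nat.div_eq_iff (by omega)]
    omega
  · exact Nat.div_eq_of_lt (by omega)

theorem Basic.rep_sub {a b : Num} {x y : ℕ} (ha : Rep v K a x) (hb : Rep v K b y) (h : y ≤ x) :
    Rep v K (a.sub b) (x - y) := by
  have hK := hB.two_le
  obtain ⟨h1, h2⟩ := hB.sub_aux ha hb
  refine hB.rep_chain (S := fun i => x % K ^ i + K ^ i - y % K ^ i)
    (by simp [Nat.mod_one]) (by simp; omega) h1 h2 fun i => ?_
  have hp := Nat.mod_lt y (pow_pos hB.pos i)
  have key : (x % K ^ i + K ^ i - y % K ^ i) + y ≡ (x - y) + y [MOD K ^ i] := by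
    rw [Nat.sub_add_cancel h]
    -- Modulo `K ^ i`, both the surplus `K ^ i` of the complement and the higher digits of `y`
    -- disappear.
    have e : (x % K ^ i + K ^ i - y % K ^ i) + y = x % K ^ i + K ^ i * (1 + y / K ^ i) := by
      have := Nat.mod_add_div y (K ^ i)
      rw [mul_add, mul_one]
      generalize x % K ^ i = A, y % K ^ i = B at *
      omega
    rw [e]
    simp [Nat.ModEq]
  exact Nat.ModEq.add_right_cancel' y key

/-- `b` if the expression `e` is `0`, and `a` if it is `1`. -/
def Num.ite (e : Expr) (a b : Num) : Num := fun i =>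
  .add (mulExpr e (a i)) (mulExpr (.get .isZero e) (b i))

/-- A jump-free case distinction, digit by digit as `e * a + (1 - e) * b`; one summand is always
zero, so there are no carries. -/
theorem Basic.rep_ite {e : Expr} {a b : Num} {x y : ℕ} {p : Prop} [Decidable p]
    (he : e.eval v = if p then 1 else 0) (ha : Rep v K a x) (hb : Rep v K b y) :
    Rep v K (Num.ite e a b) (if p then x else y) := fun i => by
  have hK := hB.two_le
  have h1 : e.eval v ≤ 1 := by rw [he]; split_ifs <;> simp
  have hz : (Expr.get .isZero e).eval v = 1 - e.eval v := hB.isZero _ h1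
  rw [Num.ite, Expr.eval_add,
    hB.eval_mulExpr (by omega) (by rw [ha i]; exact digit_lt hB.pos x i),
    hB.eval_mulExpr (by omega) (by rw [hb i]; exact digit_lt hB.pos y i), hz, he, ha i, hb i]
  split_ifs <;> simp

/-- The value of the lowest `w` digits of a number. -/
def Num.toExpr (a : Num) : ℕ → Expr
  | 0 => .cst 0
  | w + 1 => .add (a 0) (.get .scale (Num.toExpr (fun i => a (1 + i)) w))

theorem Basic.eval_toExpr {a : Num} {x w : ℕ} (ha : Rep v K a x) (hw : K ^ w ≤ Q) :
    (a.toExpr w).eval v = x % K ^ w := by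
  have hK := hB.pos
  induction w generalizing a x with
  | zero => simp [Num.toExpr, Nat.mod_one]
  | succ w ih =>
    rw [pow_succ] at hw
    have h1 := ih (ha.shift 1) ((Nat.le_mul_of_pos_right _ hK).trans hw)
    rw [pow_one] at h1
    have h2 := Nat.mod_lt (x / K) (pow_pos hK w)
    rw [Num.toExpr, Expr.eval_add, Expr.eval_get, h1, hB.scale _ (by nlinarith), ha 0, digit_zero,
      pow_succ', Nat.mod_mul, mul_comm K]

end Circuits


/-! ### Integer roots -/

/-- The largest natural number whose `c`-th power is at most `x`. -/
def iroot (c x : ℕ) : ℕ := Nat.findGreatest (fun s => s ^ c ≤ x) x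

theorem iroot_le (c x : ℕ) : iroot c x ≤ x := Nat.findGreatest_le x

theorem iroot_pow_le {c : ℕ} (hc : c ≠ 0) (x : ℕ) : iroot c x ^ c ≤ x :=
  Nat.findGreatest_spec (P := fun s => s ^ c ≤ x) (Nat.zero_le x) (by simp [hc])

theorem lt_iroot_succ_pow {c : ℕ} (hc : c ≠ 0) (x : ℕ) : x < (iroot c x + 1) ^ c := by
  by_contra! h
  have h1 : iroot c x + 1 ≤ x := (Nat.le_self_pow hc _).trans h
  have := Nat.le_findGreatest (P := fun s => s ^ c ≤ x) h1 h
  exact absurd this (by simp [iroot])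

theorem iroot_unique {c x s : ℕ} (hc : c ≠ 0) (h1 : s ^ c ≤ x) (h2 : x < (s + 1) ^ c) :
    s = iroot c x := by
  have h3 := lt_of_pow_lt_pow_left₀ c (Nat.zero_le _) (h1.trans_lt (lt_iroot_succ_pow hc x))
  have h4 := lt_of_pow_lt_pow_left₀ c (Nat.zero_le _) ((iroot_pow_le hc x).trans_lt h2)
  omega

theorem iroot_zero {c : ℕ} (hc : c ≠ 0) : iroot c 0 = 0 :=
  (iroot_unique hc (by simp [hc]) (by simp)).symm

/-- Holds because `z ^ c ≤ x / K ^ c` means `(z * K) ^ c ≤ x`. It allows the root to be extended by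
one digit for every `c` further digits of the radicand. -/
theorem iroot_div_pow {c K : ℕ} (hc : c ≠ 0) (hK : 0 < K) (x : ℕ) :
    iroot c (x / K ^ c) = iroot c x / K := by
  refine (iroot_unique hc ?_ ?_).symm
  · rw [Nat.le_div_iff_mul_le (by positivity), ← mul_pow]
    exact (Nat.pow_le_pow_left (Nat.div_mul_le_self _ _) _).trans (iroot_pow_le hc x)
  · rw [Nat.div_lt_iff_lt_mul (by positivity), ← mul_pow]
    refine (lt_iroot_succ_pow hc x).trans_le (Nat.pow_le_pow_left ?_ _)
    exact Nat.lt_mul_of_div_lt (Nat.lt_succ_self _) hK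

/-- The recurrence by which the root table is filled: as `x + 1 ≤ (iroot c x + 1) ^ c`, the root
grows by at most 1. -/
theorem iroot_succ {c : ℕ} (hc : c ≠ 0) (x : ℕ) :
    iroot c (x + 1) = iroot c x + if (iroot c x + 1) ^ c ≤ x + 1 then 1 else 0 := by
  have h1 := iroot_pow_le hc x
  have h2 := lt_iroot_succ_pow hc x
  refine (iroot_unique hc ?_ ?_).symm <;> split_ifs with h
  · exact h
  · simpa using h1.trans (Nat.le_succ x)
  · have := Nat.pow_lt_pow_left (Nat.lt_succ_self (iroot c x + 1)) hc
    simp only [Nat.succ_eq_add_one] at this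
    omega
  · simpa using h

theorem iroot_eq_floor_rpow {c : ℕ} (hc : c ≠ 0) (x : ℕ) :
    ⌊(x : ℝ) ^ (1 / (c : ℝ))⌋₊ = iroot c x := by
  have hc' : (0 : ℝ) < c := by exact_mod_cast Nat.pos_of_ne_zero hc
  have hp : ((x : ℝ) ^ (1 / (c : ℝ))) ^ c = x := by
    rw [one_div]
    exact Real.rpow_inv_natCast_pow (Nat.cast_nonneg x) hc
  have h0 : (0 : ℝ) ≤ (x : ℝ) ^ (1 / (c : ℝ)) := by positivity
  refine iroot_unique hc ?_ ?_
  · have := pow_le_pow_left₀ (Nat.cast_nonneg _) (Nat.floor_le h0) c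
    rw [hp] at this
    exact_mod_cast this
  · have := pow_lt_pow_left₀ (Nat.lt_floor_add_one ((x : ℝ) ^ (1 / (c : ℝ)))) h0 hc
    rw [hp] at this
    exact_mod_cast this

/-! ### Error bounds for the next digit -/

/-- Lower bound for a power from its linear approximation. -/
theorem pow_add_linear_le (y u n : ℕ) : y ^ (n + 1) + (n + 1) * y ^ n * u ≤ (y + u) ^ (n + 1) := by
  induction n with
  | zero => simp
  | succ n ih =>
    have := Nat.mul_le_mul_right (y + u) ih
    rw [← pow_succ] at this
    refine le_trans ?_ this
    have e : (y ^ (n + 1) + (n + 1) * y ^ n * u) * (y + u) =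
      y ^ (n + 1 + 1) + (n + 1 + 1) * y ^ (n + 1) * u + (n + 1) * y ^ n * u ^ 2 := by ring
    rw [e]
    exact Nat.le_add_right _ _

/-- Upper bound for a power from its linear approximation. -/
theorem pow_add_le_linear {y u : ℕ} (h : u ≤ y) (n : ℕ) :
    (y + u) ^ (n + 2) ≤ y ^ (n + 2) + (n + 2) * y ^ (n + 1) * u + 3 ^ (n + 2) * y ^ n * u ^ 2 := by
  induction n with
  | zero => simp only [zero_add, pow_zero]; nlinarith
  | succ n ih =>
    have := Nat.mul_le_mul_right (y + u) ih
    rw [← pow_succ] at this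
    refine this.trans ?_
    have e : (y ^ (n + 2) + (n + 2) * y ^ (n + 1) * u + 3 ^ (n + 2) * y ^ n * u ^ 2) * (y + u) =
      y ^ (n + 1 + 2) + (n + 1 + 2) * y ^ (n + 1 + 1) * u + (n + 2) * (y ^ (n + 1) * u ^ 2) +
        3 ^ (n + 2) * (y ^ (n + 1) * u ^ 2) + 3 ^ (n + 2) * (y ^ n * u ^ 2 * u) := by ring
    have h1 : y ^ n * u ^ 2 * u ≤ y ^ (n + 1) * u ^ 2 := by
      calc y ^ n * u ^ 2 * u ≤ y ^ n * u ^ 2 * y := Nat.mul_le_mul_left _ h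
        _ = _ := by ring
    have h2 : n + 2 ≤ 3 ^ (n + 2) := (Nat.lt_pow_self (by norm_num)).le
    have h3 := Nat.mul_le_mul_right (y ^ (n + 1) * u ^ 2) h2
    have h4 := Nat.mul_le_mul_left (3 ^ (n + 2)) h1
    rw [e, pow_succ 3 (n + 1 + 1)]
    nlinarith

/-- The last digit `t` of a root with leading part `y` is almost determined by the linear
approximation of the power. -/
theorem root_digit_bounds {c K y t x : ℕ} (hc : 2 ≤ c) (hK : 0 < K) (hy : K ≤ y) (ht : t < K)
    (h1 : (y * K + t) ^ c ≤ x) (h2 : x < (y * K + t + 1) ^ c) :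
    t * (c * (y * K) ^ (c - 1)) ≤ x - (y * K) ^ c ∧
      x - (y * K) ^ c < c * (y * K) ^ (c - 1) * (t + 1 + 3 ^ c) := by
  obtain ⟨n, rfl⟩ := Nat.exists_eq_add_of_le' hc
  have e : n + 2 - 1 = n + 1 := rfl
  rw [e]
  have hY : 0 < y * K := Nat.mul_pos (hK.trans_le hy) hK
  -- The point where `K ≤ y` is needed: it makes the quadratic term `(t + 1) ^ 2` no larger than
  -- `Y`.
  have hu : (t + 1) ^ 2 ≤ y * K := by
    rw [pow_two]
    exact Nat.mul_le_mul (by omega) (by omega)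
  have hu' : t + 1 ≤ y * K := (Nat.le_self_pow two_ne_zero _).trans hu
  generalize y * K = Y at *
  have l1 := pow_add_linear_le Y t (n + 1)
  have l2 := pow_add_le_linear hu' n
  have l3 : 3 ^ (n + 2) * Y ^ n * (t + 1) ^ 2 ≤ 3 ^ (n + 2) * Y ^ (n + 1) := by
    rw [pow_succ Y, ← mul_assoc]
    exact Nat.mul_le_mul_left _ hu
  -- Measured in units of `c * Y ^ (c - 1)`, the quadratic error is thus at most `3 ^ c`.
  have l4 : 1 * (3 ^ (n + 2) * Y ^ (n + 1)) ≤ (n + 2) * (3 ^ (n + 2) * Y ^ (n + 1)) :=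
    Nat.mul_le_mul_right _ (by omega)
  have hpos : 0 < Y ^ (n + 1) := by positivity
  constructor
  · apply Nat.le_sub_of_add_le
    calc _ = Y ^ (n + 1 + 1) + (n + 1 + 1) * Y ^ (n + 1) * t := by ring
      _ ≤ _ := l1.trans h1
  · have h3 : x < Y ^ (n + 2) + (n + 2) * Y ^ (n + 1) * (t + 1 + 3 ^ (n + 2)) := by
      calc x < _ := h2
        _ ≤ _ := l2
        _ ≤ _ := by rw [mul_add _ (t + 1)]; nlinarith
    have h4 : Y ^ (n + 2) ≤ x := (Nat.pow_le_pow_left (Nat.le_add_right _ _) _).trans h1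
    omega

/-- A quotient is almost determined by the leading digits of dividend and divisor. -/
theorem quot_bounds {K F t r d p : ℕ} (hK : 0 < K) (ht : t < K) (h1 : t * d ≤ r)
    (h2 : r < d * (t + 1 + F)) (hd : K ≤ d / K ^ p) :
    t ≤ r / K ^ p / (d / K ^ p) ∧ r / K ^ p / (d / K ^ p) ≤ t + 1 + 2 * F ∧
      r / K ^ p < (d / K ^ p + 1) * (K + F) := by
  have hB : 0 < K ^ p := by positivity
  generalize K ^ p = B at *
  have e1 := Nat.div_mul_le_self d B
  have e2 : d < (d / B + 1) * B := Nat.lt_mul_of_div_lt (Nat.lt_succ_self _) hB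
  have e3 := Nat.div_mul_le_self r B
  generalize d / B = g at *
  have hg : 0 < g := hK.trans_le hd
  have h3 : r / B < (g + 1) * (t + 1 + F) := by
    rw [Nat.div_lt_iff_lt_mul hB]
    calc r < d * (t + 1 + F) := h2
      _ ≤ (g + 1) * B * (t + 1 + F) := Nat.mul_le_mul_right _ e2.le
      _ = _ := by ring
  refine ⟨?_, ?_, ?_⟩
  · rw [Nat.le_div_iff_mul_le hg, Nat.le_div_iff_mul_le hB, mul_assoc]
    exact (Nat.mul_le_mul_left _ e1).trans h1
  -- Rounding the divisor costs `t + 1 + F ≤ g * (1 + F)`, since `t < K ≤ g`; this raises the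
  -- quotient by at most `1 + F`.
  · rw [← Nat.lt_succ_iff, Nat.div_lt_iff_lt_mul hg]
    refine h3.trans_le ?_
    have : F ≤ F * g := Nat.le_mul_of_pos_right _ hg
    simp only [Nat.succ_eq_add_one]
    nlinarith
  · refine h3.trans_le (Nat.mul_le_mul_left _ (by omega))

/-- The position below the leading digit, `p = Nat.log K d - 1`; it exists because `K ≤ d` gives at
least two digits. -/
theorem exists_leading_position {K d P : ℕ} (hK : 2 ≤ K) (h1 : K ≤ d) (h2 : d < K ^ P) :
    ∃ p < P, K ≤ d / K ^ p ∧ d / K ^ p < K ^ 2 := by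
  have hd : d ≠ 0 := by omega
  have hl : 1 ≤ Nat.log K d := Nat.log_pos hK h1
  have hP : Nat.log K d < P := Nat.log_lt_of_lt_pow hd h2
  refine ⟨Nat.log K d - 1, by omega, ?_, ?_⟩
  · rw [Nat.le_div_iff_mul_le (by positivity), ← pow_succ']
    rw [Nat.sub_add_cancel hl]
    exact Nat.pow_log_le_self K hd
  · rw [Nat.div_lt_iff_lt_mul (by positivity), ← pow_add]
    rw [show 2 + (Nat.log K d - 1) = Nat.log K d + 1 by omega]
    exact Nat.lt_pow_succ_log_self hK d

/-- From `3 ≤ K ^ 2`. It shows that `2 * c + 3` digits hold the leading part of the dividend, which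
is below `K ^ 2 * (K + 3 ^ c)`. -/
theorem add_three_pow_le {K c : ℕ} (hK : 2 ≤ K) (hc : 2 ≤ c) : K + 3 ^ c ≤ K ^ (2 * c + 1) := by
  have h1 : 3 ^ c ≤ K ^ (2 * c) := by
    rw [pow_mul]
    exact Nat.pow_le_pow_left (by nlinarith) c
  have h2 : K ≤ K ^ (2 * c) := Nat.le_self_pow (by omega) K
  rw [pow_succ]
  nlinarith


/-! ### Roots and quotients by candidates and tests -/

/-- The function tabulated for the division of leading digits. -/
def quotFn (a g : ℕ) : ℕ := if g = 0 then a else a / g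

theorem quotFn_le (a g : ℕ) : quotFn a g ≤ a := by
  unfold quotFn
  split_ifs
  · exact le_rfl
  · exact Nat.div_le_self _ _

/-- The entries of all tables that are used in the computation of `c`-th roots. -/
structure Full (v : Env) (K Q c : ℕ) : Prop extends Basic v K Q where
  quot : ∀ n ≤ Q, v.tab .quot n = quotFn (n / K ^ 2) (n % K ^ 2)
  root : ∀ n ≤ Q, v.tab .root n = iroot c n

/-- The number among the candidates `l` whose image under `f` is at most `X`, while that of its
successor is not. -/
def pick (f : Num → Num) (X : Num) (L : ℕ) : List Num → Num
  | [] => Num.zero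
  | a :: l => Num.ite (Num.le (f (a.add (Num.ofExpr (.cst 1)))) X L) (pick f X L l)
      (Num.ite (Num.le (f a) X L) a (pick f X L l))

section Query

variable {v : Env} {K Q : ℕ}

theorem Basic.one_le (hB : Basic v K Q) : 1 ≤ Q := by
  have := hB.sq_le
  have := hB.two_le
  nlinarith

theorem Basic.rep_one (hB : Basic v K Q) : Rep v K (Num.ofExpr (.cst 1)) 1 :=
  hB.rep_ofExpr (e := .cst 1) hB.one_le

/-- A candidate that passes the test must be `s`, by uniqueness, so wrong candidates are harmless.
They only have to be smaller than `Z`, so that `F` of them and of their successors still fits into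
`L` digits. -/
theorem Basic.rep_pick (hB : Basic v K Q) {f : Num → Num} {F : ℕ → ℕ} {X : Num} {x L Z s : ℕ}
    (hX : Rep v K X x) (hx : x < K ^ L)
    (hf : ∀ a z, z ≤ Z → Rep v K a z → Rep v K (f a) (F z) ∧ F z < K ^ L)
    (hs : F s ≤ x) (hs' : x < F (s + 1)) (hsZ : s < Z)
    (huniq : ∀ z, F z ≤ x → x < F (z + 1) → z = s) (l : List Num)
    (hl : ∀ a ∈ l, ∃ z < Z, Rep v K a z) :
    ∃ z, Rep v K (pick f X L l) z ∧ ((∃ a ∈ l, Rep v K a s) → z = s) := by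
  induction l with
  | nil => exact ⟨0, rep_zero, by simp⟩
  | cons a l ih =>
    obtain ⟨y, hy, hy'⟩ := ih fun b hb => hl b (by simp [hb])
    have key : ∀ z < Z, Rep v K a z →
        Rep v K (pick f X L (a :: l)) (if F (z + 1) ≤ x then y else if F z ≤ x then z else y) := by
      intro z hz ha
      obtain ⟨r1, b1⟩ := hf a z hz.le ha
      obtain ⟨r2, b2⟩ := hf _ (z + 1) hz (hB.rep_add ha hB.rep_one)
      exact hB.rep_ite (hB.eval_le hX r2 hx b2) hy (hB.rep_ite (hB.eval_le hX r1 hx b1) ha hy)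
    by_cases ha : Rep v K a s
    · refine ⟨s, ?_, fun _ => rfl⟩
      simpa [hs, not_le.2 hs'] using key s hsZ ha
    · obtain ⟨z, hz, haz⟩ := hl a (by simp)
      refine ⟨_, key z hz haz, fun h => ?_⟩
      have h' : ∃ b ∈ l, Rep v K b s := by
        obtain ⟨b, hb, hbs⟩ := h
        rcases List.mem_cons.1 hb with rfl | hb
        · exact absurd hbs ha
        · exact ⟨b, hb, hbs⟩
      split_ifs with h1 h2
      · exact hy' h'
      · exact huniq z h2 (not_le.1 h1)
      · exact hy' h'

/-- The table entry for the quotient of the leading digits at position `p`. -/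
def quotExpr (w : ℕ) (R D : Num) (p : ℕ) : Expr :=
  .get .quot (.add (.get .scale (.get .scale (Num.toExpr (fun i => R (p + i)) w)))
    (Num.toExpr (fun i => D (p + i)) 2))

/-- The index consists of `w` digits of the dividend above 2 digits of the divisor, whence `K ^ (w +
2) ≤ Q`. The bound by `Q` is also valid at useless positions `p`. -/
theorem Full.eval_quotExpr {c : ℕ} (hF : Full v K Q c) {R D : Num} {r d w : ℕ}
    (hw : K ^ (w + 2) ≤ Q) (hR : Rep v K R r) (hD : Rep v K D d) (p : ℕ) :
    (quotExpr w R D p).eval v = quotFn (r / K ^ p % K ^ w) (d / K ^ p % K ^ 2) ∧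
      (quotExpr w R D p).eval v ≤ Q := by
  have hB := hF.toBasic
  have hK := hB.pos
  have e1 := hB.eval_toExpr (hR.shift p) (w := w)
    ((Nat.pow_le_pow_right hK (by omega)).trans hw)
  have e2 := hB.eval_toExpr (hD.shift p) (w := 2) hB.sq_le
  have l1 := Nat.mod_lt (r / K ^ p) (pow_pos hK w)
  have l2 := Nat.mod_lt (d / K ^ p) (pow_pos hK 2)
  have l3 : r / K ^ p % K ^ w * K ^ 2 + d / K ^ p % K ^ 2 < K ^ (w + 2) := by
    rw [pow_add]
    nlinarith
  have l4 : r / K ^ p % K ^ w * K * K + d / K ^ p % K ^ 2 < K ^ (w + 2) := by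
    rwa [mul_assoc, ← pow_two]
  have key : (quotExpr w R D p).eval v = quotFn (r / K ^ p % K ^ w) (d / K ^ p % K ^ 2) := by
    simp only [quotExpr, Expr.eval_get, Expr.eval_add, e1, e2]
    rw [hB.scale (r / K ^ p % K ^ w) (by nlinarith), hB.scale _ (by omega), mul_assoc, ← pow_two,
      hF.quot _ (by omega), mul_comm _ (K ^ 2), Nat.mul_add_div (by positivity),
      Nat.div_eq_of_lt l2, Nat.mul_add_mod, add_zero, Nat.mod_mod]
  refine ⟨key, ?_⟩
  rw [key]
  refine (quotFn_le _ _).trans ?_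
  have : r / K ^ p % K ^ w ≤ r / K ^ p % K ^ w * K ^ 2 :=
    Nat.le_mul_of_pos_right _ (by positivity)
  omega

/-- Candidates for the number with last digit close to the quotient of `R` and `D`, the other digits
being those of `y`. -/
def quotCands (P E w : ℕ) (R D y : Num) : List Num :=
  (List.range P).flatMap fun p => (List.range E).map fun e =>
    (y.shl 1).add (Num.ofExpr ((Expr.get .pred)^[e] (quotExpr w R D p)))

theorem Basic.eval_iterate_pred (hB : Basic v K Q) {e : Expr} (he : e.eval v ≤ Q) (i : ℕ) :
    ((Expr.get .pred)^[i] e).eval v = e.eval v - i := by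
  induction i with
  | zero => simp
  | succ i ih =>
    rw [Function.iterate_succ_apply', Expr.eval_get, hB.pred _ (by rw [ih]; omega), ih,
      Nat.sub_sub]

/-- Controls the size of the wrong candidates too, as `Basic.rep_pick` requires. -/
theorem Full.rep_of_mem_quotCands {c : ℕ} (hF : Full v K Q c) {R D y : Num} {r d y₀ w P E : ℕ}
    (hw : K ^ (w + 2) ≤ Q) (hR : Rep v K R r) (hD : Rep v K D d) (hy : Rep v K y y₀) :
    ∀ a ∈ quotCands P E w R D y, ∃ z ≤ y₀ * K + Q, Rep v K a z := by
  intro a ha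
  simp only [quotCands, List.mem_flatMap, List.mem_map] at ha
  obtain ⟨p, -, e, -, rfl⟩ := ha
  obtain ⟨h1, h2⟩ := hF.eval_quotExpr hw hR hD p
  have h3 := hF.eval_iterate_pred h2 e
  have h4 : ((Expr.get .pred)^[e] (quotExpr w R D p)).eval v ≤ Q := by omega
  refine ⟨_, ?_, hF.rep_add (hF.rep_shl hy 1) (hF.rep_ofExpr h4)⟩
  rw [pow_one]
  omega

/-- At the right position `p` the truncations in the table index lose nothing, and the tabulated
quotient `q` satisfies `t ≤ q ≤ t + 1 + 2 * F`. One of the `2 * F + 2` corrections `q - e` is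
therefore `t`. -/
theorem Full.exists_mem_quotCands {c : ℕ} (hF : Full v K Q c) {R D y : Num}
    {r d y₀ t w P F : ℕ} (hw : K ^ (w + 2) ≤ Q) (hR : Rep v K R r) (hD : Rep v K D d)
    (hy : Rep v K y y₀) (ht : t < K) (h1 : t * d ≤ r) (h2 : r < d * (t + 1 + F)) (hd : K ≤ d)
    (hP : d < K ^ P) (hKF : K ^ 2 * (K + F) ≤ K ^ w) :
    ∃ a ∈ quotCands P (2 * F + 2) w R D y, Rep v K a (y₀ * K + t) := by
  obtain ⟨p, hpP, hp1, hp2⟩ := exists_leading_position hF.two_le hd hP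
  obtain ⟨b1, b2, b3⟩ := quot_bounds hF.pos ht h1 h2 hp1
  obtain ⟨e1, e2⟩ := hF.eval_quotExpr hw hR hD p
  have l1 : r / K ^ p < K ^ w :=
    (b3.trans_le (Nat.mul_le_mul_right _ hp2)).trans_le hKF
  have hK := hF.pos
  rw [Nat.mod_eq_of_lt l1, Nat.mod_eq_of_lt hp2, quotFn, if_neg (by omega)] at e1
  set q := r / K ^ p / (d / K ^ p) with hq
  have h3 := hF.eval_iterate_pred e2 (q - t)
  rw [e1, Nat.sub_sub_self b1] at h3
  have h4 : t ≤ Q := by omega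
  refine ⟨(y.shl 1).add (Num.ofExpr ((Expr.get .pred)^[q - t] (quotExpr w R D p))), ?_, ?_⟩
  · simp only [quotCands, List.mem_flatMap, List.mem_map, List.mem_range]
    exact ⟨p, hpP, q - t, by omega, rfl⟩
  · have := hF.rep_add (hF.rep_shl hy 1) (hF.rep_ofExpr (h3.trans_le h4))
    rwa [h3, pow_one] at this

/-- The `c`-th root of `X`, if `y` is that root without its last digit. -/
def rootStep (c L : ℕ) (X y : Num) : Num :=
  pick (fun a => a.pow L c) X L
    (Num.ofExpr (.get .root (X.toExpr (2 * c))) ::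
      quotCands L (2 * 3 ^ c + 2) (2 * c + 3) ((X.sub ((y.shl 1).pow L c)).shl 1)
        ((((y.shl 1).pow L (c - 1)).mul (Num.ofExpr (.cst c)) L).shl 1) y)

/-- By `Basic.rep_pick` it only remains to see that the true root is among the candidates. -/
theorem Full.rep_rootStep {c : ℕ} (hc : 2 ≤ c) (hF : Full v K Q c) {X y : Num} {x L : ℕ}
    (hX : Rep v K X x) (hy : Rep v K y (iroot c x / K)) (hcQ : c ≤ Q)
    (hQ : K ^ (2 * c + 5) ≤ Q) (hL : (iroot c x + Q + 1) ^ c * K < K ^ L) :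
    Rep v K (rootStep c L X y) (iroot c x) := by
  have hB := hF.toBasic
  have hK := hB.pos
  have hK2 := hB.two_le
  have hc0 : c ≠ 0 := by omega
  have hs1 := iroot_pow_le hc0 x
  have hs2 := lt_iroot_succ_pow hc0 x
  have hdm := Nat.div_add_mod' (iroot c x) K
  have ht := Nat.mod_lt (iroot c x) hK
  set s := iroot c x with hs
  set y₀ := s / K with hy₀
  set t := s % K with ht₀
  have hL' : (s + Q + 1) ^ c < K ^ L :=
    lt_of_le_of_lt (Nat.le_mul_of_pos_right _ hK) hL
  have hpow : ∀ z ≤ s + Q + 1, z < K ^ L ∧ z ^ c < K ^ L := fun z hz =>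
    have h := (Nat.pow_le_pow_left hz c).trans_lt hL'
    ⟨(Nat.le_self_pow hc0 z).trans_lt h, h⟩
  have hx : x < K ^ L := hs2.trans_le ((Nat.pow_le_pow_left (by omega) c).trans hL'.le)
  have hY : Rep v K (y.shl 1) (y₀ * K) := by simpa using hB.rep_shl hy 1
  have hYL : y₀ * K < K ^ L := (hpow _ (by omega)).1
  have hYx : (y₀ * K) ^ c ≤ x := (Nat.pow_le_pow_left (by omega) c).trans hs1
  have hcL : c < K ^ L := (hpow c (by omega)).1
  have hR : Rep v K ((X.sub ((y.shl 1).pow L c)).shl 1) ((x - (y₀ * K) ^ c) * K) := by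
    simpa using hB.rep_shl (hB.rep_sub hX (hB.rep_pow hY hYL c) hYx) 1
  have hD : Rep v K ((((y.shl 1).pow L (c - 1)).mul (Num.ofExpr (.cst c)) L).shl 1)
      ((y₀ * K) ^ (c - 1) * c * K) := by
    simpa using hB.rep_shl (hB.rep_mul (hB.rep_pow hY hYL (c - 1))
      (hB.rep_ofExpr (e := .cst c) hcQ) hcL) 1
  have hXt : (X.toExpr (2 * c)).eval v = x % K ^ (2 * c) :=
    hB.eval_toExpr hX ((Nat.pow_le_pow_right hK (by omega)).trans hQ)
  have hXQ : x % K ^ (2 * c) ≤ Q :=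
    (Nat.mod_lt _ (by positivity)).le.trans ((Nat.pow_le_pow_right hK (by omega)).trans hQ)
  have hroot : (Expr.get .root (X.toExpr (2 * c))).eval v = iroot c (x % K ^ (2 * c)) := by
    rw [Expr.eval_get, hXt, hF.root _ hXQ]
  have hrootQ := (iroot_le c (x % K ^ (2 * c))).trans hXQ
  have hrootR := hB.rep_ofExpr (hroot.trans_le hrootQ)
  rw [hroot] at hrootR
  obtain ⟨z, hz, hz'⟩ := hB.rep_pick (f := fun a => a.pow L c) (F := fun z => z ^ c)
    (Z := s + Q + 1) (s := s) hX hx (fun a z hz ha => ⟨hB.rep_pow ha (hpow z hz).1 c, (hpow z hz).2⟩)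
    hs1 hs2 (by omega) (fun z h1 h2 => iroot_unique hc0 h1 h2)
    (Num.ofExpr (.get .root (X.toExpr (2 * c))) ::
      quotCands L (2 * 3 ^ c + 2) (2 * c + 3) ((X.sub ((y.shl 1).pow L c)).shl 1)
        ((((y.shl 1).pow L (c - 1)).mul (Num.ofExpr (.cst c)) L).shl 1) y) (by
      intro a ha
      rcases List.mem_cons.1 ha with rfl | ha
      · exact ⟨_, by omega, hrootR⟩
      · obtain ⟨z, hz, h⟩ := hF.rep_of_mem_quotCands hQ hR hD hy a ha
        exact ⟨z, by omega, h⟩)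
  rw [rootStep, ← hz' ?_]
  · exact hz
  -- If `y₀ < K`, the root is below `K ^ 2`, so `x < K ^ (2 * c)` and the candidate from the root
  -- table is exact. Otherwise the linear approximation applies.
  rcases lt_or_ge y₀ K with hlt | hge
  · refine ⟨_, List.mem_cons_self, ?_⟩
    have hxlt : x < K ^ (2 * c) := by
      rw [pow_mul]
      refine hs2.trans_le (Nat.pow_le_pow_left ?_ c)
      nlinarith
    rwa [Nat.mod_eq_of_lt hxlt] at hrootR
  · obtain ⟨b1, b2⟩ := root_digit_bounds (x := x) hc hK hge ht (by rwa [hdm]) (by rwa [hdm])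
    have hYpos : 0 < y₀ * K := Nat.mul_pos (hK.trans_le hge) hK
    obtain ⟨a, ha, has⟩ := hF.exists_mem_quotCands (F := 3 ^ c) (P := L) (t := t) hQ hR hD hy ht
      (by
        calc t * ((y₀ * K) ^ (c - 1) * c * K) = t * (c * (y₀ * K) ^ (c - 1)) * K := by ring
          _ ≤ _ := Nat.mul_le_mul_right _ b1)
      (by
        calc (x - (y₀ * K) ^ c) * K < c * (y₀ * K) ^ (c - 1) * (t + 1 + 3 ^ c) * K :=
              Nat.mul_lt_mul_of_pos_right b2 hK
          _ = _ := by ring)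
      (Nat.le_mul_of_pos_left _ (by positivity))
      (by
        refine lt_of_le_of_lt (Nat.mul_le_mul_right _ ?_) hL
        obtain ⟨n, rfl⟩ := Nat.exists_eq_add_of_le' hc
        rw [pow_succ _ (n + 1)]
        exact Nat.mul_le_mul (Nat.pow_le_pow_left (by omega) _) (by omega))
      (by
        rw [show 2 * c + 3 = 2 + (2 * c + 1) by ring, pow_add]
        exact Nat.mul_le_mul_left _ (add_three_pow_le hK2 hc))
    rw [hdm] at has
    exact ⟨a, List.mem_cons_of_mem _ ha, has⟩

/-- The quotient of `X` and `n`, if `y` is that quotient without its last digit. -/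
def divStep (c L : ℕ) (n X y : Num) : Num :=
  pick (fun a => a.mul n L) X L (quotCands L (2 * 3 ^ c + 2) (2 * c + 3)
    ((X.sub ((y.shl 1).mul n L)).shl 1) (n.shl 1) y)

/-- The analogue of `Full.rep_rootStep` for the map `z * n₀`, which is linear, so there is no
approximation error to allow for; the slack `3 ^ c` is kept in order to share the table layout and
its bounds. -/
theorem Full.rep_divStep {c : ℕ} (hc : 2 ≤ c) (hF : Full v K Q c) {X y n : Num} {x n₀ L : ℕ}
    (hX : Rep v K X x) (hn : Rep v K n n₀) (hn₀ : 0 < n₀) (hnQ : n₀ ≤ Q)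
    (hy : Rep v K y (x / n₀ / K))
    (hQ : K ^ (2 * c + 5) ≤ Q) (hL : (x + Q + 1) * (Q * K) < K ^ L) :
    Rep v K (divStep c L n X y) (x / n₀) := by
  have hB := hF.toBasic
  have hK := hB.pos
  have hK2 := hB.two_le
  have hQ1 := hB.one_le
  have hs1 := Nat.div_mul_le_self x n₀
  have hs2 : x < (x / n₀ + 1) * n₀ := Nat.lt_mul_of_div_lt (Nat.lt_succ_self _) hn₀
  have hsx := Nat.div_le_self x n₀
  have hdm := Nat.div_add_mod' (x / n₀) K
  have ht := Nat.mod_lt (x / n₀) hK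
  set s := x / n₀ with hs
  set y₀ := s / K with hy₀
  set t := s % K with ht₀
  have hQK : 0 < Q * K := Nat.mul_pos hQ1 hK
  have hnK : n₀ * K ≤ Q * K := Nat.mul_le_mul_right _ hnQ
  have hnK' : n₀ ≤ n₀ * K := Nat.le_mul_of_pos_right _ hK
  have hnL : n₀ * K < K ^ L := by nlinarith
  have hnL' : n₀ < K ^ L := by omega
  have hx : x < K ^ L := by nlinarith
  have hY : Rep v K (y.shl 1) (y₀ * K) := by simpa using hB.rep_shl hy 1
  have hYx : y₀ * K * n₀ ≤ x := (Nat.mul_le_mul_right _ (by omega)).trans hs1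
  have hR : Rep v K ((X.sub ((y.shl 1).mul n L)).shl 1) ((x - y₀ * K * n₀) * K) := by
    simpa using hB.rep_shl (hB.rep_sub hX (hB.rep_mul hY hn hnL') hYx) 1
  -- The divisor may have a single digit. Multiplying it and the remainder by `K` provides the two
  -- leading digits without changing the quotient.
  have hD : Rep v K (n.shl 1) (n₀ * K) := by simpa using hB.rep_shl hn 1
  obtain ⟨z, hz, hz'⟩ := hB.rep_pick (f := fun a => a.mul n L) (F := fun z => z * n₀)
    (Z := s + Q + 1) (s := s) hX hx
    (fun a z hz ha => ⟨hB.rep_mul ha hn hnL', lt_of_le_of_lt (Nat.mul_le_mul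
      (hz.trans (by omega)) (hnQ.trans (Nat.le_mul_of_pos_right _ hK))) hL⟩)
    hs1 hs2 (by omega)
    (fun z h1 h2 => by
      have := (Nat.le_div_iff_mul_le hn₀).2 h1
      have := (Nat.div_lt_iff_lt_mul hn₀).2 h2
      omega)
    (quotCands L (2 * 3 ^ c + 2) (2 * c + 3)
      ((X.sub ((y.shl 1).mul n L)).shl 1) (n.shl 1) y) (by
      intro a ha
      obtain ⟨z, hz, h⟩ := hF.rep_of_mem_quotCands hQ hR hD hy a ha
      exact ⟨z, by omega, h⟩)
  rw [divStep, ← hz' ?_]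
  · exact hz
  have e1 : (y₀ * K + t) * n₀ ≤ x := by rwa [hdm]
  have e2 : x < (y₀ * K + t + 1) * n₀ := by rwa [hdm]
  obtain ⟨a, ha, has⟩ := hF.exists_mem_quotCands (F := 3 ^ c) (P := L) (t := t) hQ hR hD hy ht
    (by
      rw [← mul_assoc]
      refine Nat.mul_le_mul_right _ (Nat.le_sub_of_add_le ?_)
      calc _ = (y₀ * K + t) * n₀ := by ring
        _ ≤ x := e1)
    (by
      have h1 : x - y₀ * K * n₀ < n₀ * (t + 1) := by
        rw [Nat.sub_lt_iff_lt_add hYx]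
        calc x < _ := e2
          _ = _ := by ring
      calc (x - y₀ * K * n₀) * K < n₀ * (t + 1) * K := Nat.mul_lt_mul_of_pos_right h1 hK
        _ ≤ n₀ * (t + 1 + 3 ^ c) * K :=
          Nat.mul_le_mul_right _ (Nat.mul_le_mul_left _ (Nat.le_add_right _ _))
        _ = _ := by ring)
    (Nat.le_mul_of_pos_left _ hn₀) hnL
    (by
      rw [show 2 * c + 3 = 2 + (2 * c + 1) by ring, pow_add]
      exact Nat.mul_le_mul_left _ (add_three_pow_le hK2 hc))
  rw [hdm] at has
  exact ⟨a, ha, has⟩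

/-- The `c`-th root of the number without the lowest `c * (M - j)` digits of `X`. -/
def rootStages (c L M : ℕ) (X : Num) : ℕ → Num
  | 0 => Num.zero
  | j + 1 => rootStep c L (fun i => X (c * (M - (j + 1)) + i)) (rootStages c L M X j)

/-- Stage `j` brings in `c` more digits of `x`, and by `iroot_div_pow` its root without the last
digit is the result of the stage before. -/
theorem Full.rep_rootStages {c : ℕ} (hc : 2 ≤ c) (hF : Full v K Q c) {X : Num} {x L M : ℕ}
    (hX : Rep v K X x) (hx : x < K ^ (c * M)) (hcQ : c ≤ Q) (hQ : K ^ (2 * c + 5) ≤ Q)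
    (hL : (K ^ M + Q) ^ c * K < K ^ L) {j : ℕ} (hj : j ≤ M) :
    Rep v K (rootStages c L M X j) (iroot c (x / K ^ (c * (M - j)))) := by
  have hc0 : c ≠ 0 := by omega
  have hK := hF.pos
  have hle : ∀ p, iroot c (x / K ^ p) < K ^ M := fun p => by
    refine lt_of_pow_lt_pow_left₀ c (Nat.zero_le _) ?_
    rw [← pow_mul, mul_comm M]
    exact ((iroot_pow_le hc0 _).trans (Nat.div_le_self _ _)).trans_lt hx
  induction j with
  | zero => rw [Nat.sub_zero, Nat.div_eq_of_lt hx, iroot_zero hc0]; exact rep_zero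
  | succ j ih =>
    refine hF.rep_rootStep hc (hX.shift _) ?_ hcQ hQ ?_
    · rw [← iroot_div_pow hc0 hK, Nat.div_div_eq_div_mul, ← pow_add,
        show c * (M - (j + 1)) + c = c * (M - j) by
          rw [← Nat.mul_succ]; congr 1; omega]
      exact ih (by omega)
    · refine lt_of_le_of_lt (Nat.mul_le_mul_right _ (Nat.pow_le_pow_left ?_ _)) hL
      have := hle (c * (M - (j + 1)))
      omega

/-- The quotient of the number without the lowest `M - j` digits of `X` and of `n`. -/
def divStages (c L M : ℕ) (n X : Num) : ℕ → Num
  | 0 => Num.zero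
  | j + 1 => divStep c L n (fun i => X (M - (j + 1) + i)) (divStages c L M n X j)

/-- Long division: dividing by `K` and by `n₀` commutes, so the previous stage supplies the quotient
without its last digit. -/
theorem Full.rep_divStages {c : ℕ} (hc : 2 ≤ c) (hF : Full v K Q c) {X n : Num} {x n₀ L M : ℕ}
    (hX : Rep v K X x) (hn : Rep v K n n₀) (hn₀ : 0 < n₀) (hnQ : n₀ ≤ Q) (hx : x < K ^ M)
    (hQ : K ^ (2 * c + 5) ≤ Q) (hL : (K ^ M + Q) * (Q * K) < K ^ L) {j : ℕ} (hj : j ≤ M) :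
    Rep v K (divStages c L M n X j) (x / K ^ (M - j) / n₀) := by
  induction j with
  | zero => rw [Nat.sub_zero, Nat.div_eq_of_lt hx, Nat.zero_div]; exact rep_zero
  | succ j ih =>
    refine hF.rep_divStep hc (hX.shift _) hn hn₀ hnQ ?_ hQ ?_
    · rw [Nat.div_right_comm, Nat.div_div_eq_div_mul x, ← pow_succ,
        show M - (j + 1) + 1 = M - j by omega]
      exact ih (by omega)
    · refine lt_of_le_of_lt (Nat.mul_le_mul_right _ ?_) hL
      have := Nat.div_le_self x (K ^ (M - (j + 1)))
      omega

/-! ### Conversion between base `N` and base `K`; the query expressions -/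

/-- The number with `k` digits in base `n` that are in the input registers from `i` on. -/
def inputNum (n : Num) (L : ℕ) : ℕ → ℕ → Num
  | _, 0 => Num.zero
  | i, k + 1 => (Num.ofExpr (.inp i)).add ((inputNum n L (i + 1) k).mul n L)

theorem Basic.rep_inputNum (hB : Basic v K Q) {n : Num} {x n₀ L : ℕ} (hn : Rep v K n n₀)
    (hn₀ : 0 < n₀) (hnQ : n₀ ≤ Q) (hnL : n₀ < K ^ L) (hinp : v.inp = digit n₀ x) (i k : ℕ) :
    Rep v K (inputNum n L i k) (x / n₀ ^ i % n₀ ^ k) := by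
  induction k generalizing i with
  | zero => simpa [inputNum, Nat.mod_one] using rep_zero
  | succ k ih =>
    have h1 : (Expr.inp i).eval v = digit n₀ x i := by simp [hinp]
    have h2 : (Expr.inp i).eval v ≤ Q := by
      have := digit_lt hn₀ x i
      omega
    have := hB.rep_add (hB.rep_ofExpr h2) (hB.rep_mul (ih (i + 1)) hn hnL)
    rw [h1] at this
    refine (congrArg (Rep v K _) ?_).mp this
    rw [pow_succ' n₀ k, Nat.mod_mul, digit, mul_comm n₀, Nat.div_div_eq_div_mul, pow_succ n₀ i]

/-- The number without its `j` lowest digits in base `n`. -/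
def quotNum (c L M : ℕ) (n X : Num) : ℕ → Num
  | 0 => X
  | j + 1 => divStages c L M n (quotNum c L M n X j) M

theorem Full.rep_quotNum {c : ℕ} (hc : 2 ≤ c) (hF : Full v K Q c) {X n : Num} {x n₀ L M : ℕ}
    (hX : Rep v K X x) (hn : Rep v K n n₀) (hn₀ : 0 < n₀) (hnQ : n₀ ≤ Q) (hx : x < K ^ M)
    (hQ : K ^ (2 * c + 5) ≤ Q) (hL : (K ^ M + Q) * (Q * K) < K ^ L) (j : ℕ) :
    Rep v K (quotNum c L M n X j) (x / n₀ ^ j) := by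
  induction j with
  | zero => simpa [quotNum] using hX
  | succ j ih =>
    have := hF.rep_divStages hc ih hn hn₀ hnQ ((Nat.div_le_self _ _).trans_lt hx) hQ hL le_rfl
    simpa [quotNum, Nat.div_div_eq_div_mul, pow_succ] using this

/-- The digit `j` in base `n` of a number, where `n` has at most `m` digits in the base used for
the representation. -/
def digitExpr (c L M m : ℕ) (n X : Num) (j : ℕ) : Expr :=
  ((quotNum c L M n X j).sub ((quotNum c L M n X (j + 1)).mul n L)).toExpr m

/-- The digit is the remainder of `x / n₀ ^ j` modulo `n₀`, got by subtraction. Being below `K ^ m ≤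
Q`, it can be assembled into one register. -/
theorem Full.eval_digitExpr {c : ℕ} (hc : 2 ≤ c) (hF : Full v K Q c) {X n : Num}
    {x n₀ L M m : ℕ}
    (hX : Rep v K X x) (hn : Rep v K n n₀) (hn₀ : 0 < n₀) (hnm : n₀ < K ^ m) (hm : K ^ m ≤ Q)
    (hx : x < K ^ M) (hQ : K ^ (2 * c + 5) ≤ Q) (hL : (K ^ M + Q) * (Q * K) < K ^ L) (j : ℕ) :
    (digitExpr c L M m n X j).eval v = digit n₀ x j := by
  have hnQ : n₀ ≤ Q := by omega
  have hQ1 := hF.one_le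
  have hK := hF.pos
  have hQK : Q ≤ Q * K := Nat.le_mul_of_pos_right _ hK
  have hnL : n₀ < K ^ L := by nlinarith
  have h1 := hF.rep_quotNum hc hX hn hn₀ hnQ hx hQ hL j
  have h2 := hF.rep_mul (hF.rep_quotNum hc hX hn hn₀ hnQ hx hQ hL (j + 1)) hn hnL
  rw [pow_succ, ← Nat.div_div_eq_div_mul] at h2
  have h3 := hF.rep_sub h1 h2 (Nat.div_mul_le_self _ _)
  have e : x / n₀ ^ j - x / n₀ ^ j / n₀ * n₀ = digit n₀ x j := by
    have := Nat.div_add_mod' (x / n₀ ^ j) n₀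
    rw [digit]
    omega
  rw [e] at h3
  rw [digitExpr, hF.eval_toExpr h3 hm, Nat.mod_eq_of_lt ((digit_lt hn₀ x j).trans hnm)]

/-- The number of digits in the representation of the input size. -/
def digitsN (c : ℕ) : ℕ := 2 * c + 6

/-- A bound for the number of digits of all numbers in the computation of roots. -/
def digitsBound (c d : ℕ) : ℕ := c * (digitsN c * d + digitsN c + 1) + 2

/-- The digits of the `c`-th root of the number whose `d` digits are in the input registers. -/
def queryExprs (c d : ℕ) : List Expr :=
  (List.range d).map (digitExpr c (digitsBound c d) (digitsN c * d) (digitsN c)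
    (Num.ofExpr .size) (rootStages c (digitsBound c d) (digitsN c * d)
      (inputNum (Num.ofExpr .size) (digitsBound c d) 0 d) (digitsN c * d)))

theorem Full.map_eval_queryExprs {c d x : ℕ} (hc : 2 ≤ c) (hF : Full v K (K ^ digitsN c) c)
    (hN : 0 < v.size) (hNK : v.size < K ^ digitsN c) (hinp : v.inp = digit v.size x)
    (hx : x < v.size ^ d) :
    (queryExprs c d).map (Expr.eval v) = digitList v.size d (iroot c x) := by
  have hK := hF.pos
  have hK2 := hF.two_le
  have hpow : ∀ {i j : ℕ}, i ≤ j → K ^ i ≤ K ^ j := fun h => Nat.pow_le_pow_right hK h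
  have hQ : K ^ (2 * c + 5) ≤ K ^ digitsN c := hpow (by simp [digitsN])
  have hcQ : c ≤ K ^ digitsN c := (Nat.lt_pow_self hK2).le.trans (hpow (by simp [digitsN]; omega))
  have hsum : K ^ (digitsN c * d) + K ^ digitsN c ≤ K ^ (digitsN c * d + digitsN c + 1) := by
    have h1 := @hpow (digitsN c * d) (digitsN c * d + digitsN c) (by omega)
    have h2 := @hpow (digitsN c) (digitsN c * d + digitsN c) (by omega)
    rw [pow_succ]
    nlinarith
  have hLb : 2 * (digitsN c * d + digitsN c + 1) + 2 ≤ digitsBound c d :=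
    Nat.add_le_add_right (Nat.mul_le_mul_right _ hc) 2
  have hL1 : (K ^ (digitsN c * d) + K ^ digitsN c) ^ c * K < K ^ digitsBound c d := by
    calc _ ≤ (K ^ (digitsN c * d + digitsN c + 1)) ^ c * K :=
          Nat.mul_le_mul_right _ (Nat.pow_le_pow_left hsum c)
      _ = K ^ (c * (digitsN c * d + digitsN c + 1) + 1) := by rw [← pow_mul, pow_succ, mul_comm c]
      _ < _ := Nat.pow_lt_pow_right hK2 (by simp [digitsBound])
  have hL2 : (K ^ (digitsN c * d) + K ^ digitsN c) * (K ^ digitsN c * K) <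
      K ^ digitsBound c d := by
    calc _ ≤ K ^ (digitsN c * d + digitsN c + 1) * (K ^ digitsN c * K) :=
          Nat.mul_le_mul_right _ hsum
      _ = K ^ (digitsN c * d + digitsN c + 1 + (digitsN c + 1)) := by ring
      _ < _ := Nat.pow_lt_pow_right hK2 (by omega)
  have hNL : v.size < K ^ digitsBound c d := hNK.trans_le (hpow (by omega))
  have hn : Rep v K (Num.ofExpr .size) v.size := hF.rep_ofExpr (e := .size) hNK.le
  have hX : Rep v K (inputNum (Num.ofExpr .size) (digitsBound c d) 0 d) x := by
    simpa [Nat.mod_eq_of_lt hx] using hF.rep_inputNum hn hN hNK.le hNL hinp 0 d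
  have hxM : x < K ^ (digitsN c * d) := by
    rw [pow_mul]
    exact hx.trans_le (Nat.pow_le_pow_left hNK.le d)
  -- With `M = digitsN c * d`, already `x < K ^ M`, so `M` stages are more than enough.
  have hroot := hF.rep_rootStages hc hX (hxM.trans_le (hpow (Nat.le_mul_of_pos_left _ (by omega))))
    hcQ hQ hL1 le_rfl
  simp only [Nat.sub_self, mul_zero, pow_zero, Nat.div_one] at hroot
  simp only [queryExprs, digitList, List.map_map]
  refine List.map_congr_left fun j _ => ?_
  exact hF.eval_digitExpr hc hroot hn hN hNK le_rfl ((iroot_le c x).trans_lt hxM) hQ hL2 j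

end Query


/-! ### Loops that fill tables and find the base -/

/-- The loop counter. -/
def ctrE : Expr := .get .ctr (.cst 0)

/-- Variable `i`. -/
def varE (i : ℕ) : Expr := .get .var (.cst i)

/-- The loop that fills the array `T`, in which the first entries are given, for all `i` that come
before the mark in the array `Z`: entry `i + st` becomes `ev`. -/
def tabulate (T Z : Arr) (st ev : Expr) : List Stmt :=
  [.asg ⟨.ctr, .cst 0, .cst 0⟩,
    .loop (.get .isZero (.get Z ctrE)) [⟨T, .add ctrE st, ev⟩, ⟨.ctr, .cst 0, .add ctrE (.cst 1)⟩]]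

section Loops

variable {N M : ℕ} {I : ℕ → ℕ}

theorem bd_assign {σ : Arr → ℕ → ℕ} (h : (Env.mk N I σ).Bd M) (a : Arr) (i : ℕ) {x : ℕ}
    (hx : x ≤ M) : (Env.mk N I (assign σ a i x)).Bd M := by
  refine ⟨h.1, h.2, h.3, fun a' i' => ?_⟩
  simp only [assign_apply]
  split_ifs
  · exact hx
  · exact h.4 a' i'

theorem assign_of_ne {σ : Arr → ℕ → ℕ} {a a' : Arr} (h : a' ≠ a) (i x : ℕ) :
    assign σ a i x a' = σ a' := by
  funext n
  simp [assign_apply, h]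

/-- Induction on the number `r` of remaining iterations. The machine cannot compare numbers, so the
end of the loop is recognized by the mark in `Z`. -/
theorem runs_tabulate_loop {T Z : Arr} {st ev : Expr} {e s : ℕ} {f : ℕ → ℕ} {σ : Arr → ℕ → ℕ}
    (hTc : T ≠ .ctr) (hTi : T ≠ .isZero) (hTZ : Z ≠ T) (hZc : Z ≠ .ctr)
    (hi0 : σ .isZero 0 = 1) (hi1 : σ .isZero 1 = 0) (hZ0 : ∀ n < e, σ Z n = 0) (hZ1 : σ Z e = 1)
    (hf : ∀ n < e + s, f n ≤ M) (he : e ≤ M)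
    (hstep : ∀ τ i, i < e → (∀ a, a ≠ T → a ≠ .ctr → τ a = σ a) → τ .ctr 0 = i →
      (∀ n < i + s, τ T n = f n) → st.eval ⟨N, I, τ⟩ = s ∧ ev.eval ⟨N, I, τ⟩ = f (i + s))
    (r : ℕ) (hr : r ≤ e) (τ : Arr → ℕ → ℕ) (hM : (Env.mk N I τ).Bd M)
    (hτ : ∀ a, a ≠ T → a ≠ .ctr → τ a = σ a) (hτc : τ .ctr 0 = e - r)
    (hτT : ∀ n < e - r + s, τ T n = f n) (hτT' : ∀ n ≥ e - r + s, τ T n = σ T n) :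
    ∃ σ', Runs N I M [.loop (.get .isZero (.get Z ctrE))
        [⟨T, .add ctrE st, ev⟩, ⟨.ctr, .cst 0, .add ctrE (.cst 1)⟩]] τ (r + 1) σ' ∧
      (∀ a, a ≠ T → a ≠ .ctr → σ' a = σ a) ∧ (∀ n < e + s, σ' T n = f n) ∧
      ∀ n ≥ e + s, σ' T n = σ T n := by
  have hic : Arr.isZero ≠ .ctr := by decide
  induction r generalizing τ with
  | zero =>
    refine ⟨τ, .finish hM ?_ (.nil hM), hτ, hτT, hτT'⟩
    simp [ctrE, hτc, hτ Z hTZ hZc, hτ .isZero hTi.symm hic, hZ1, hi1]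
  | succ r ih =>
    have hlt : e - (r + 1) < e := by omega
    obtain ⟨h1, h2⟩ := hstep τ (e - (r + 1)) hlt hτ hτc hτT
    have e1 : execAll N I τ [⟨T, .add ctrE st, ev⟩, ⟨.ctr, .cst 0, .add ctrE (.cst 1)⟩] =
        assign (assign τ T (e - (r + 1) + s) (f (e - (r + 1) + s))) .ctr 0 (e - r) := by
      simp only [execAll, List.foldl, Asg.exec, Expr.eval_add, ctrE, Expr.eval_get, Expr.eval_cst,
        h1, h2, assign_of_ne hTc.symm, hτc]
      congr 1
      omega
    obtain ⟨σ', hσ', hrest⟩ := ih (by omega) (assign (assign τ T (e - (r + 1) + s)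
      (f (e - (r + 1) + s))) .ctr 0 (e - r))
      (bd_assign (bd_assign hM _ _ (hf _ (by omega))) _ _ (by omega))
      (fun a ha hac => by rw [assign_of_ne hac, assign_of_ne ha, hτ a ha hac])
      (by simp [assign_apply])
      (fun n hn => by
        rw [assign_of_ne hTc, assign_apply]
        split_ifs with h
        · rw [h.2]
        · exact hτT n (by simp only [true_and] at h; omega))
      (fun n hn => by
        rw [assign_of_ne hTc, assign_apply, if_neg (by omega)]
        exact hτT' n (by omega))
    refine ⟨σ', .next hM ?_ (e1 ▸ hσ'), hrest⟩
    simp [ctrE, hτc, hτ Z hTZ hZc, hτ .isZero hTi.symm hic, hZ0 _ hlt, hi0]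

theorem runs_tabulate {T Z : Arr} {st ev : Expr} {e s : ℕ} {f : ℕ → ℕ} {σ : Arr → ℕ → ℕ}
    (hTc : T ≠ .ctr) (hTi : T ≠ .isZero) (hTZ : Z ≠ T) (hZc : Z ≠ .ctr)
    (hi0 : σ .isZero 0 = 1) (hi1 : σ .isZero 1 = 0) (hZ0 : ∀ n < e, σ Z n = 0) (hZ1 : σ Z e = 1)
    (hf : ∀ n < e + s, f n ≤ M) (he : e ≤ M)
    (hstep : ∀ τ i, i < e → (∀ a, a ≠ T → a ≠ .ctr → τ a = σ a) → τ .ctr 0 = i →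
      (∀ n < i + s, τ T n = f n) → st.eval ⟨N, I, τ⟩ = s ∧ ev.eval ⟨N, I, τ⟩ = f (i + s))
    (hM : (Env.mk N I σ).Bd M) (hbase : ∀ n < s, σ T n = f n) :
    ∃ σ', Runs N I M (tabulate T Z st ev) σ (e + 2) σ' ∧
      (∀ a, a ≠ T → a ≠ .ctr → σ' a = σ a) ∧ (∀ n < e + s, σ' T n = f n) ∧
      ∀ n ≥ e + s, σ' T n = σ T n := by
  obtain ⟨σ', hσ', hrest⟩ := runs_tabulate_loop hTc hTi hTZ hZc hi0 hi1 hZ0 hZ1 hf he hstep e le_rfl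
    (assign σ .ctr 0 0) (bd_assign hM _ _ (Nat.zero_le _)) (fun a _ hac => assign_of_ne hac _ _)
    (by simp [assign_apply])
    (fun n hn => by rw [assign_of_ne hTc]; exact hbase n (by omega))
    (fun n hn => by rw [assign_of_ne hTc])
  exact ⟨σ', .asg hM hσ', hrest⟩

/-- Twice the value of an expression. -/
def Expr.double (e : Expr) : Expr := .add e e

theorem Expr.eval_iterate_double (v : Env) (e : Expr) (j : ℕ) :
    (Expr.double^[j] e).eval v = 2 ^ j * e.eval v := by
  induction j with
  | zero => simp
  | succ j ih => rw [Function.iterate_succ_apply', double, eval_add, ih]; ring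

/-- The loop that determines a power `K` of two such that `K ^ m` is larger than the input size, but
not much larger, and keeps `K`, `K ^ (m - 1)` and `K ^ m` in variables. -/
def baseLoop (m : ℕ) : List Stmt :=
  [.loop (.get .small (varE 2)) [⟨.var, .cst 0, Expr.double (varE 0)⟩,
    ⟨.var, .cst 1, Expr.double^[m - 1] (varE 1)⟩, ⟨.var, .cst 2, Expr.double^[m] (varE 2)⟩]]

/-- The array `small` serves as the test `K ^ m ≤ N`. The body runs only if this holds, so `K ^ m`
never exceeds `2 ^ m * N`; and `K ^ m` grows at each pass, so `r` bounds the number of passes. -/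
theorem runs_baseLoop {m : ℕ} (hm : 1 ≤ m) (hN : 0 < N) (hNM : 2 ^ m * N ≤ M) (r : ℕ)
    {σ : Arr → ℕ → ℕ} (hM : (Env.mk N I σ).Bd M)
    (hsmall : ∀ n, σ .small n = if n ≤ N then 1 else 0) {K : ℕ} (hK : 1 ≤ K)
    (h0 : σ .var 0 = K) (h1 : σ .var 1 = K ^ (m - 1)) (h2 : σ .var 2 = K ^ m)
    (hKN : K ^ m ≤ 2 ^ m * N) (hr : N + 1 ≤ r + K ^ m) :
    ∃ σ' n K', n ≤ r + 1 ∧ Runs N I M (baseLoop m) σ n σ' ∧ 2 ≤ K' ∧ N < K' ^ m ∧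
      K' ^ m ≤ 2 ^ m * N ∧ σ' .var 0 = K' ∧ σ' .var 1 = K' ^ (m - 1) ∧ σ' .var 2 = K' ^ m ∧
      ∀ a ≠ .var, σ' a = σ a := by
  have h_large : N < K ^ m → ∃ σ' n K', n ≤ r + 1 ∧ Runs N I M (baseLoop m) σ n σ' ∧ 2 ≤ K' ∧
      N < K' ^ m ∧ K' ^ m ≤ 2 ^ m * N ∧ σ' .var 0 = K' ∧ σ' .var 1 = K' ^ (m - 1) ∧
      σ' .var 2 = K' ^ m ∧ ∀ a ≠ .var, σ' a = σ a := by
    intro hlt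
    refine ⟨σ, 1, K, by omega, .finish hM ?_ (.nil hM), ?_, hlt, hKN, h0, h1, h2, fun _ _ => rfl⟩
    · simp only [varE, Expr.eval_get, Expr.eval_cst, h2, hsmall, if_neg (not_le.2 hlt)]
    · by_contra h
      obtain rfl : K = 1 := by omega
      rw [one_pow] at hlt
      omega
  induction r generalizing σ K with
  | zero => exact h_large (by omega)
  | succ r ih =>
    rcases lt_or_ge N (K ^ m) with hlt | hge
    · exact h_large hlt
    · have e1 : execAll N I σ [⟨.var, .cst 0, Expr.double (varE 0)⟩,
          ⟨.var, .cst 1, Expr.double^[m - 1] (varE 1)⟩,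
          ⟨.var, .cst 2, Expr.double^[m] (varE 2)⟩] =
          assign (assign (assign σ .var 0 (2 * K)) .var 1 ((2 * K) ^ (m - 1))) .var 2
            ((2 * K) ^ m) := by
        rw [mul_pow, mul_pow]
        simp only [execAll, List.foldl, Asg.exec, Expr.eval_iterate_double, Expr.double,
          Expr.eval_add, varE, Expr.eval_get, Expr.eval_cst, h0, assign_apply, h1, h2, two_mul]
        norm_num
      have hpow : (2 * K) ^ m ≤ 2 ^ m * N := by
        rw [mul_pow]
        exact Nat.mul_le_mul_left _ hge
      have hle : (2 * K) ^ (m - 1) ≤ M :=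
        (Nat.pow_le_pow_right (by omega) (Nat.sub_le _ _)).trans (hpow.trans hNM)
      have hle0 : 2 * K ≤ M := (Nat.le_self_pow (by omega) _).trans (hpow.trans hNM)
      have hlt : K ^ m < (2 * K) ^ m := Nat.pow_lt_pow_left (by omega) (by omega)
      have hM' := bd_assign (bd_assign (bd_assign hM .var 0 hle0) .var 1 hle) .var 2
        (hpow.trans hNM)
      have hs' : ∀ n, assign (assign (assign σ .var 0 (2 * K)) .var 1 ((2 * K) ^ (m - 1))) .var 2
          ((2 * K) ^ m) .small n = if n ≤ N then 1 else 0 := fun n => by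
        rw [assign_of_ne (by decide), assign_of_ne (by decide), assign_of_ne (by decide), hsmall]
      obtain ⟨σ', n, K', hn, hruns, p1, p2, p3, p4, p5, p6, p7⟩ := ih hM' hs'
        (K := 2 * K) (by omega) (by simp [assign_apply]) (by simp [assign_apply])
        (by simp [assign_apply]) hpow (by omega) (fun h => by
          refine ⟨_, 1, 2 * K, by omega, .finish hM' ?_ (.nil hM'), by omega, h, hpow,
            by simp [assign_apply], by simp [assign_apply], by simp [assign_apply], fun _ _ => rfl⟩
          simp only [varE, Expr.eval_get, Expr.eval_cst, hs']
          simp [assign_apply, h])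
      refine ⟨σ', n + 1, K', by omega, .next hM ?_ (e1 ▸ hruns), p1, p2, p3, p4, p5, p6, ?_⟩
      · simp [varE, h2, hsmall, hge]
      · intro a ha
        rw [p7 a ha, assign_of_ne ha, assign_of_ne ha, assign_of_ne ha]

end Loops


/-! ### The individual tables -/

/-- What the arrays contain after the precomputation. -/
def Good (K m c : ℕ) : Arr → (ℕ → ℕ) → Prop
  | .var, g => g 0 = K ∧ g 1 = K ^ (m - 1) ∧ g 2 = K ^ m
  | .ctr, _ => True
  | .small, _ => True
  | .endN, _ => True
  | .endQ, g => (∀ n < K ^ m, g n = 0) ∧ g (K ^ m) = 1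
  | .endP, g => (∀ n < K ^ (m - 1), g n = 0) ∧ g (K ^ (m - 1)) = 1
  | .div, g => ∀ n ≤ K ^ m, g n = n / K
  | .mod, g => ∀ n ≤ K ^ m, g n = n % K
  | .scale, g => ∀ n ≤ K ^ (m - 1), g n = n * K
  | .pred, g => ∀ n ≤ K ^ m, g n = n - 1
  | .comp, g => ∀ n ≤ K ^ m, g n = K - 1 - n
  | .mul, g => ∀ n ≤ K ^ m, g n = n / K * (n % K)
  | .isZero, g => g 0 = 1 ∧ g 1 = 0
  | .quot, g => ∀ n ≤ K ^ m, g n = quotFn (n / K ^ 2) (n % K ^ 2)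
  | .root, g => ∀ n ≤ K ^ m, g n = iroot c n

/-- The arrays in `S` have their final contents, and all others are still zero. -/
structure Inv (K m c : ℕ) (S : Finset Arr) (σ : Arr → ℕ → ℕ) : Prop where
  good : ∀ a ∈ S, Good K m c a (σ a)
  zero : ∀ a ∉ S, a ≠ .ctr → ∀ n, σ a n = 0

section Precomputation

variable {N M : ℕ} {I : ℕ → ℕ} {K m c : ℕ} {S : Finset Arr} {σ : Arr → ℕ → ℕ}

theorem Inv.insert (h : Inv K m c S σ) {σ' : Arr → ℕ → ℕ} {T : Arr}
    (hfr : ∀ a, a ≠ T → a ≠ .ctr → σ' a = σ a) (hg : Good K m c T (σ' T)) :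
    Inv K m c (insert T S) σ' := by
  refine ⟨fun a ha => ?_, fun a ha hac n => ?_⟩
  · by_cases haT : a = T
    · rw [haT]; exact hg
    · by_cases hac : a = .ctr
      · rw [hac]; trivial
      · rw [hfr a haT hac]
        exact h.good a ((Finset.mem_insert.1 ha).resolve_left haT)
  · rw [Finset.mem_insert, not_or] at ha
    rw [hfr a ha.1 hac]
    exact h.zero a ha.2 hac n

/-- The start state `σ₀` may differ from `σ` in `T`, because `T` can already hold initial entries or
the result of an earlier pass. -/
theorem Inv.exists_tabulate (h : Inv K m c S σ) {T Z : Arr} {st ev : Expr} {e s : ℕ} {f : ℕ → ℕ}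
    (hT : T ∉ S) (hTc : T ≠ .ctr) (hi : .isZero ∈ S) (hZ : Z ∈ S) (hZc : Z ≠ .ctr)
    (hend : (∀ n < e, σ Z n = 0) ∧ σ Z e = 1) (hf : ∀ n < e + s, f n ≤ M) (he : e ≤ M)
    (hstep : ∀ τ i, i < e → (∀ a ∈ S, Good K m c a (τ a)) → τ .ctr 0 = i →
      (∀ n < i + s, τ T n = f n) → st.eval ⟨N, I, τ⟩ = s ∧ ev.eval ⟨N, I, τ⟩ = f (i + s))
    {σ₀ : Arr → ℕ → ℕ} (hσ₀ : ∀ a, a ≠ T → a ≠ .ctr → σ₀ a = σ a)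
    (hM : (Env.mk N I σ₀).Bd M) (hbase : ∀ n < s, σ₀ T n = f n) :
    ∃ σ', Runs N I M (tabulate T Z st ev) σ₀ (e + 2) σ' ∧
      (∀ a, a ≠ T → a ≠ .ctr → σ' a = σ a) ∧ ∀ n < e + s, σ' T n = f n := by
  have hne : ∀ a ∈ S, a ≠ T := fun a ha haT => hT (haT ▸ ha)
  have hi' : σ₀ .isZero = σ .isZero := hσ₀ _ (hne _ hi) (by decide)
  have hZ' : σ₀ Z = σ Z := hσ₀ _ (hne _ hZ) hZc
  have hgi := h.good _ hi
  obtain ⟨σ', h1, h2, h3, -⟩ := runs_tabulate (N := N) (I := I) (f := f) hTc (hne _ hi).symm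
    (hne _ hZ) hZc (hi' ▸ hgi.1) (hi' ▸ hgi.2) (hZ' ▸ hend.1) (hZ' ▸ hend.2) hf he
    (fun τ i hlt hfr => hstep τ i hlt fun a ha => by
      by_cases hac : a = .ctr
      · rw [hac]; trivial
      · rw [hfr a (hne a ha) hac, hσ₀ a (hne a ha) hac]
        exact h.good a ha) hM hbase
  exact ⟨σ', h1, fun a haT hac => (h2 a haT hac).trans (hσ₀ a haT hac), h3⟩

/-- The statements `l` fill the array `T`, in linear time, if the arrays in `S` have been filled. -/
def Fills (N M : ℕ) (I : ℕ → ℕ) (K m c : ℕ) (l : List Stmt) (S : Finset Arr) (T : Arr) : Prop :=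
  ∀ σ, Inv K m c S σ → (Env.mk N I σ).Bd M → ∃ σ' n, n ≤ 6 * M ∧ Runs N I M l σ n σ' ∧
    Inv K m c (insert T S) σ'

/-- The arrays that are filled before the first table. -/
def auxArrs : Finset Arr := {.isZero, .small, .endN, .var, .endQ, .endP}

/-- The arrays needed for the arithmetic of long numbers. -/
def basicArrs : Finset Arr := {.mul, .comp, .pred, .scale, .mod, .div} ∪ auxArrs

/-- The statements that fill the array for division by the base. -/
def divStmts : List Stmt := tabulate .div .endQ (varE 0) (.add (.get .div ctrE) (.cst 1))

/-- The statements that fill the array for remainders. -/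
def modStmts : List Stmt :=
  tabulate .mod .endQ (.cst 1) (.add (.get .mod ctrE) (.cst 1)) ++
    tabulate .mod .endQ (varE 0) (.get .mod ctrE)

/-- The statements that fill the array for multiplication by the base. -/
def scaleStmts : List Stmt := tabulate .scale .endP (.cst 1) (.add (.get .scale ctrE) (varE 0))

/-- The statements that fill the array for predecessors. -/
def predStmts : List Stmt := tabulate .pred .endQ (.cst 1) ctrE

/-- The statements that fill the array for complementary digits. -/
def compStmts : List Stmt :=
  .asg ⟨.comp, .cst 0, .get .pred (varE 0)⟩ ::
    tabulate .comp .endQ (.cst 1) (.get .pred (.get .comp ctrE))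

/-- The statements that fill the array for products of digits. -/
def mulStmts : List Stmt :=
  tabulate .mul .endQ (varE 0) (.add (.get .mul ctrE) (.get .mod ctrE))

/-- The statements that fill the array for small roots. -/
def rootStmts (c m : ℕ) : List Stmt :=
  tabulate .root .endQ (.cst 1) (.add (.get .root ctrE)
    (Num.le ((Num.ofExpr (.add (.get .root ctrE) (.cst 1))).pow (c * (m + 1)) c)
      (Num.ofExpr (.add ctrE (.cst 1))) (c * (m + 1))))

/-- The statements that fill the array for quotients of leading digits. -/
def quotStmts (m : ℕ) : List Stmt :=
  tabulate .quot .endQ (.get .scale (varE 0)) (.add (.get .quot ctrE)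
    (Num.le ((Num.ofExpr (.add (.get .quot ctrE) (.cst 1))).mul
        (Num.ofExpr ((Num.ofExpr ctrE).toExpr 2)) (2 * (m + 1)))
      (Num.add (fun i => Num.ofExpr ctrE (2 + i)) (Num.ofExpr (.cst 1))) (2 * (m + 1))))

theorem pow_pred_mul {m : ℕ} (hm : 1 ≤ m) (K : ℕ) : K ^ (m - 1) * K = K ^ m := by
  rw [← pow_succ, Nat.sub_add_cancel hm]

theorem basic_of_good (hK : 2 ≤ K) (hm : 2 ≤ m) (h : ∀ a ∈ basicArrs, Good K m c a (σ a)) :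
    Basic ⟨N, I, σ⟩ K (K ^ m) where
  two_le := hK
  sq_le := Nat.pow_le_pow_right (by omega) hm
  div := h .div (by decide)
  mod := h .mod (by decide)
  scale n hn := h .scale (by decide) n (by
    rw [← pow_pred_mul (by omega)] at hn
    exact Nat.le_of_mul_le_mul_right hn (by omega))
  pred := h .pred (by decide)
  comp n hn := h .comp (by decide) n (hn.le.trans (Nat.le_self_pow (by omega) K))
  mul := h .mul (by decide)
  isZero n hn := by
    have := h .isZero (by decide)
    interval_cases n
    · exact this.1
    · exact this.2

theorem le_bounds (hK : 2 ≤ K) (hm : 2 ≤ m) : K ≤ K ^ m ∧ K ^ 2 ≤ K ^ m ∧ K ^ (m - 1) ≤ K ^ m ∧ 1 ≤ K ^ m :=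
  ⟨Nat.le_self_pow (by omega) K, Nat.pow_le_pow_right (by omega) hm,
    Nat.pow_le_pow_right (by omega) (by omega), Nat.one_le_pow _ _ (by omega)⟩

variable (hK : 2 ≤ K) (hm : 2 ≤ m) (hM : 2 * K ^ m ≤ M)

include hK hm hM

/-- Entry `i + K` is entry `i` plus 1; the first `K` entries are right because fresh registers are
0. -/
theorem fills_div (h1 : auxArrs ⊆ S) (h2 : .div ∉ S) : Fills N M I K m c divStmts S .div := by
  intro σ h hb
  obtain ⟨b1, b2, b3, b4⟩ := le_bounds hK hm
  obtain ⟨σ', r, fr, hv⟩ := h.exists_tabulate (N := N) (I := I) (M := M) (T := .div) (Z := .endQ)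
    (e := K ^ m) (s := K) (f := fun n => n / K) (st := varE 0)
    (ev := .add (.get .div ctrE) (.cst 1)) h2 (by decide) (h1 (by decide))
    (h1 (by decide)) (by decide) (h.good .endQ (h1 (by decide)))
    (fun n hn => (Nat.div_le_self n K).trans (by omega)) (by omega)
    (fun τ i hi hS hc hT => by
      have hvar := hS .var (h1 (by decide))
      refine ⟨hvar.1, ?_⟩
      simp only [Expr.eval_add, Expr.eval_get, ctrE, Expr.eval_cst, hc]
      rw [hT i (by omega), Nat.add_div_right _ (by omega)])
    (fun _ _ _ => rfl) hb
    (fun n hn => by rw [Nat.div_eq_of_lt hn]; exact h.zero _ h2 (by decide) n)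
  exact ⟨σ', _, by omega, r, h.insert fr fun n hn => hv n (by omega)⟩

theorem fills_mod (h1 : auxArrs ⊆ S) (h2 : .mod ∉ S) : Fills N M I K m c modStmts S .mod := by
  intro σ h hb
  obtain ⟨b1, b2, b3, b4⟩ := le_bounds hK hm
  -- A first pass writes the identity, which is correct below `K`; the second overwrites the rest
  -- with period `K`.
  obtain ⟨σ₁, r₁, fr₁, hv₁⟩ := h.exists_tabulate (N := N) (I := I) (M := M) (T := .mod)
    (Z := .endQ) (e := K ^ m) (s := 1) (f := fun n => n) (st := .cst 1)
    (ev := .add (.get .mod ctrE) (.cst 1)) h2 (by decide) (h1 (by decide))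
    (h1 (by decide)) (by decide) (h.good .endQ (h1 (by decide)))
    (fun n hn => by omega) (by omega)
    (fun τ i hi hS hc hT => by
      simp only [Expr.eval_add, Expr.eval_get, ctrE, Expr.eval_cst, hc]
      exact ⟨trivial, by rw [hT i (by omega)]⟩)
    (fun _ _ _ => rfl) hb
    (fun n hn => by
      obtain rfl : n = 0 := by omega
      exact h.zero _ h2 (by decide) 0)
  obtain ⟨σ', r, fr, hv⟩ := h.exists_tabulate (N := N) (I := I) (M := M) (T := .mod) (Z := .endQ)
    (e := K ^ m) (s := K) (f := fun n => n % K) (st := varE 0)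
    (ev := .get .mod ctrE) h2 (by decide) (h1 (by decide))
    (h1 (by decide)) (by decide) (h.good .endQ (h1 (by decide)))
    (fun n hn => (Nat.mod_le n K).trans (by omega)) (by omega)
    (fun τ i hi hS hc hT => by
      have hvar := hS .var (h1 (by decide))
      refine ⟨hvar.1, ?_⟩
      simp only [Expr.eval_get, ctrE, Expr.eval_cst, hc]
      rw [hT i (by omega), Nat.add_mod_right])
    fr₁ r₁.bd_right
    (fun n hn => by rw [Nat.mod_eq_of_lt hn]; exact hv₁ n (by omega))
  exact ⟨σ', _, by omega, r₁.append r, h.insert fr fun n hn => hv n (by omega)⟩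

/-- This table ends at `K ^ (m - 1)`, where its values reach `K ^ m`; hence the separate mark
`endP`. -/
theorem fills_scale (h1 : auxArrs ⊆ S) (h2 : .scale ∉ S) :
    Fills N M I K m c scaleStmts S .scale := by
  intro σ h hb
  obtain ⟨b1, b2, b3, b4⟩ := le_bounds hK hm
  have e0 := pow_pred_mul (show 1 ≤ m by omega) K
  obtain ⟨σ', r, fr, hv⟩ := h.exists_tabulate (N := N) (I := I) (M := M) (T := .scale)
    (Z := .endP) (e := K ^ (m - 1)) (s := 1) (f := fun n => n * K) (st := .cst 1)
    (ev := .add (.get .scale ctrE) (varE 0)) h2 (by decide) (h1 (by decide))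
    (h1 (by decide)) (by decide) (h.good .endP (h1 (by decide)))
    (fun n hn => by
      have : n * K ≤ K ^ (m - 1) * K := Nat.mul_le_mul_right _ (by omega)
      omega) (by omega)
    (fun τ i hi hS hc hT => by
      have hvar := hS .var (h1 (by decide))
      simp only [Expr.eval_add, Expr.eval_get, ctrE, Expr.eval_cst, hc, varE, hvar.1]
      refine ⟨trivial, ?_⟩
      rw [hT i (by omega)]
      ring)
    (fun _ _ _ => rfl) hb
    (fun n hn => by
      obtain rfl : n = 0 := by omega
      rw [zero_mul]
      exact h.zero _ h2 (by decide) 0)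
  exact ⟨σ', _, by omega, r, h.insert fr fun n hn => hv n (by omega)⟩

theorem fills_pred (h1 : auxArrs ⊆ S) (h2 : .pred ∉ S) :
    Fills N M I K m c predStmts S .pred := by
  intro σ h hb
  obtain ⟨b1, b2, b3, b4⟩ := le_bounds hK hm
  obtain ⟨σ', r, fr, hv⟩ := h.exists_tabulate (N := N) (I := I) (M := M) (T := .pred)
    (Z := .endQ) (e := K ^ m) (s := 1) (f := fun n => n - 1) (st := .cst 1)
    (ev := ctrE) h2 (by decide) (h1 (by decide))
    (h1 (by decide)) (by decide) (h.good .endQ (h1 (by decide)))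
    (fun n hn => by omega) (by omega)
    (fun τ i hi hS hc hT => ⟨rfl, hc⟩)
    (fun _ _ _ => rfl) hb
    (fun n hn => by
      obtain rfl : n = 0 := by omega
      exact h.zero _ h2 (by decide) 0)
  exact ⟨σ', _, by omega, r, h.insert fr fun n hn => hv n (by omega)⟩

theorem fills_comp (h1 : auxArrs ⊆ S) (h1' : .pred ∈ S) (h2 : .comp ∉ S) :
    Fills N M I K m c compStmts S .comp := by
  intro σ h hb
  obtain ⟨b1, b2, b3, b4⟩ := le_bounds hK hm
  have e0 : (Asg.mk .comp (.cst 0) (.get .pred (varE 0))).exec N I σ =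
      assign σ .comp 0 (K - 1) := by
    have hvar := h.good .var (h1 (by decide))
    have hpred := h.good .pred h1' K b1
    simp only [Asg.exec, Expr.eval_get, varE, Expr.eval_cst, hvar.1, hpred]
  obtain ⟨σ', r, fr, hv⟩ := h.exists_tabulate (N := N) (I := I) (M := M) (T := .comp)
    (Z := .endQ) (e := K ^ m) (s := 1) (f := fun n => K - 1 - n) (st := .cst 1)
    (ev := .get .pred (.get .comp ctrE)) h2 (by decide) (h1 (by decide))
    (h1 (by decide)) (by decide) (h.good .endQ (h1 (by decide)))
    (fun n hn => by omega) (by omega)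
    (fun τ i hi hS hc hT => by
      have hpred := hS .pred h1' (K - 1 - i) (by omega)
      simp only [Expr.eval_get, ctrE, Expr.eval_cst, hc]
      refine ⟨trivial, ?_⟩
      rw [hT i (by omega), hpred]
      omega)
    (σ₀ := assign σ .comp 0 (K - 1))
    (fun a ha _ => assign_of_ne ha _ _) (bd_assign hb _ _ (by omega))
    (fun n hn => by
      obtain rfl : n = 0 := by omega
      simp [assign_apply])
  exact ⟨σ', _, by omega, .asg hb (e0 ▸ r), h.insert fr fun n hn => hv n (by omega)⟩

/-- Passing from `i` to `i + K` raises the upper factor by 1 and keeps the lower one, so the entry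
grows by `i % K`. -/
theorem fills_mul (h1 : auxArrs ⊆ S) (h1' : .mod ∈ S) (h2 : .mul ∉ S) :
    Fills N M I K m c mulStmts S .mul := by
  intro σ h hb
  obtain ⟨b1, b2, b3, b4⟩ := le_bounds hK hm
  obtain ⟨σ', r, fr, hv⟩ := h.exists_tabulate (N := N) (I := I) (M := M) (T := .mul) (Z := .endQ)
    (e := K ^ m) (s := K) (f := fun n => n / K * (n % K)) (st := varE 0)
    (ev := .add (.get .mul ctrE) (.get .mod ctrE)) h2 (by decide) (h1 (by decide))
    (h1 (by decide)) (by decide) (h.good .endQ (h1 (by decide)))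
    (fun n hn => by
      have := Nat.mul_le_mul_left (n / K) (Nat.mod_lt n (show 0 < K by omega)).le
      have := Nat.div_mul_le_self n K
      omega) (by omega)
    (fun τ i hi hS hc hT => by
      have hvar := hS .var (h1 (by decide))
      have hmod := hS .mod h1' i hi.le
      refine ⟨hvar.1, ?_⟩
      simp only [Expr.eval_add, Expr.eval_get, ctrE, Expr.eval_cst, hc]
      rw [hT i (by omega), hmod, Nat.add_div_right _ (by omega), Nat.add_mod_right,
        Nat.succ_mul])
    (fun _ _ _ => rfl) hb
    (fun n hn => by
      rw [Nat.div_eq_of_lt hn, zero_mul]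
      exact h.zero _ h2 (by decide) n)
  exact ⟨σ', _, by omega, r, h.insert fr fun n hn => hv n (by omega)⟩

/-- The recurrence `iroot_succ`, with the test on the `c`-th power done in long arithmetic; that
power is at most `K ^ (c * m)`, so `c * (m + 1)` digits suffice. -/
theorem fills_root (hc : 2 ≤ c) (h1 : basicArrs ⊆ S) (h2 : .root ∉ S) :
    Fills N M I K m c (rootStmts c m) S .root := by
  intro σ h hb
  have hc0 : c ≠ 0 := by omega
  obtain ⟨b1, b2, b3, b4⟩ := le_bounds hK hm
  obtain ⟨σ', r, fr, hv⟩ := h.exists_tabulate (N := N) (I := I) (M := M) (T := .root)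
    (Z := .endQ) (e := K ^ m) (s := 1) (f := iroot c) (st := .cst 1)
    (ev := (.add (.get .root ctrE)
    (Num.le ((Num.ofExpr (.add (.get .root ctrE) (.cst 1))).pow (c * (m + 1)) c)
      (Num.ofExpr (.add ctrE (.cst 1))) (c * (m + 1))))) h2 (by decide) (h1 (by decide))
    (h1 (by decide)) (by decide) (h.good .endQ (h1 (by decide)))
    (fun n hn => (iroot_le c n).trans (by omega)) (by omega)
    (fun τ i hi hS hctr hT => by
      have hB : Basic ⟨N, I, τ⟩ K (K ^ m) := basic_of_good hK hm fun a ha => hS a (h1 ha)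
      have e1 : (Expr.get .root ctrE).eval ⟨N, I, τ⟩ = iroot c i := by
        simp only [Expr.eval_get, ctrE, Expr.eval_cst, hctr]
        exact hT i (by omega)
      have e2 : (Expr.add (.get .root ctrE) (.cst 1)).eval ⟨N, I, τ⟩ = iroot c i + 1 := by
        rw [Expr.eval_add, e1, Expr.eval_cst]
      have e3 : (Expr.add ctrE (.cst 1)).eval ⟨N, I, τ⟩ = i + 1 := by
        simp only [Expr.eval_add, Expr.eval_get, ctrE, Expr.eval_cst, hctr]
      have hri := iroot_le c i
      have l0 : K ^ m < K ^ (c * (m + 1)) := Nat.pow_lt_pow_right hK (by nlinarith)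
      have r1 := hB.rep_ofExpr (e := .add (.get .root ctrE) (.cst 1)) (by rw [e2]; omega)
      have r2 := hB.rep_ofExpr (e := .add ctrE (.cst 1)) (by rw [e3]; omega)
      rw [e2] at r1
      rw [e3] at r2
      refine ⟨rfl, ?_⟩
      rw [Expr.eval_add, e1, hB.eval_le r2 (hB.rep_pow r1 (by omega) c) (by omega), iroot_succ hc0]
      calc (iroot c i + 1) ^ c ≤ (K ^ m) ^ c := Nat.pow_le_pow_left (by omega) c
        _ = K ^ (c * m) := by rw [← pow_mul, mul_comm]
        _ < _ := Nat.pow_lt_pow_right hK (by nlinarith))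
    (fun _ _ _ => rfl) hb
    (fun n hn => by
      obtain rfl : n = 0 := by omega
      rw [iroot_zero hc0]
      exact h.zero _ h2 (by decide) 0)
  exact ⟨σ', _, by omega, r, h.insert fr fun n hn => hv n (by omega)⟩

omit hK hm hM in
-- For `g = 0` the test always succeeds. The convention `quotFn a 0 = a` makes the recurrence
-- uniform, so the loop need not treat a zero divisor separately.
theorem quotFn_succ (a g : ℕ) :
    quotFn (a + 1) g = quotFn a g + if (quotFn a g + 1) * g ≤ a + 1 then 1 else 0 := by
  unfold quotFn
  split_ifs with h0 h1 h1
  · rfl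
  · simp [h0] at h1
  · refine Nat.div_eq_of_lt_le h1 ?_
    have := Nat.lt_mul_of_div_lt (Nat.lt_succ_self (a / g)) (Nat.pos_of_ne_zero h0)
    simp only [Nat.succ_eq_add_one] at this ⊢
    nlinarith [Nat.pos_of_ne_zero h0]
  · refine Nat.div_eq_of_lt_le ?_ (by simpa using h1)
    simpa using (Nat.div_mul_le_self a g).trans (Nat.le_succ a)

theorem fills_quot (h1 : basicArrs ⊆ S) (h2 : .quot ∉ S) :
    Fills N M I K m c (quotStmts m) S .quot := by
  intro σ h hb
  obtain ⟨b1, b2, b3, b4⟩ := le_bounds hK hm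
  have hKpos : 0 < K ^ 2 := by positivity
  obtain ⟨σ', r, fr, hv⟩ := h.exists_tabulate (N := N) (I := I) (M := M) (T := .quot)
    (Z := .endQ) (e := K ^ m) (s := K ^ 2) (f := fun n => quotFn (n / K ^ 2) (n % K ^ 2))
    (st := .get .scale (varE 0)) (ev := (.add (.get .quot ctrE)
    (Num.le ((Num.ofExpr (.add (.get .quot ctrE) (.cst 1))).mul
        (Num.ofExpr ((Num.ofExpr ctrE).toExpr 2)) (2 * (m + 1)))
      (Num.add (fun i => Num.ofExpr ctrE (2 + i)) (Num.ofExpr (.cst 1))) (2 * (m + 1)))))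
    h2 (by decide) (h1 (by decide))
    (h1 (by decide)) (by decide) (h.good .endQ (h1 (by decide)))
    (fun n hn => (quotFn_le _ _).trans ((Nat.div_le_self _ _).trans (by omega))) (by omega)
    (fun τ i hi hS hctr hT => by
      have hB : Basic ⟨N, I, τ⟩ K (K ^ m) := basic_of_good hK hm fun a ha => hS a (h1 ha)
      have e0 : (Expr.get .scale (varE 0)).eval ⟨N, I, τ⟩ = K ^ 2 := by
        have hvar := hS .var (h1 (by decide))
        simp only [Expr.eval_get, varE, Expr.eval_cst, hvar.1]
        rw [pow_two]
        exact hB.scale K (by rw [← pow_two]; exact b2)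
      have ec : ctrE.eval ⟨N, I, τ⟩ = i := hctr
      set q := quotFn (i / K ^ 2) (i % K ^ 2) with hq
      have e1 : (Expr.get .quot ctrE).eval ⟨N, I, τ⟩ = q := by
        rw [Expr.eval_get, ec]
        exact hT i (by omega)
      have e2 : (Expr.add (.get .quot ctrE) (.cst 1)).eval ⟨N, I, τ⟩ = q + 1 := by
        rw [Expr.eval_add, e1, Expr.eval_cst]
      have hqi : q ≤ i / K ^ 2 := quotFn_le _ _
      have hii : i / K ^ 2 ≤ i := Nat.div_le_self _ _
      have hmod := Nat.mod_lt i hKpos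
      have l0 : K ^ m * K ^ 2 < K ^ (2 * (m + 1)) := by
        rw [← pow_add]
        exact Nat.pow_lt_pow_right hK (by omega)
      have rc := hB.rep_ofExpr (e := ctrE) (by rw [ec]; omega)
      rw [ec] at rc
      have r1 := hB.rep_ofExpr (e := .add (.get .quot ctrE) (.cst 1)) (by rw [e2]; omega)
      rw [e2] at r1
      have e3 := hB.eval_toExpr rc b2
      have r3 := hB.rep_ofExpr (e := (Num.ofExpr ctrE).toExpr 2) (by rw [e3]; omega)
      rw [e3] at r3
      have r4 := hB.rep_add (rc.shift 2) hB.rep_one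
      have l1 : K ^ m ≤ K ^ m * K ^ 2 := Nat.le_mul_of_pos_right _ hKpos
      refine ⟨e0, ?_⟩
      rw [Expr.eval_add, e1, hB.eval_le r4 (hB.rep_mul r1 r3 (by omega)) (by omega)
        ((Nat.mul_le_mul (by omega) hmod.le).trans_lt l0), Nat.add_div_right _ hKpos,
        Nat.add_mod_right]
      exact (quotFn_succ _ _).symm)
    (fun _ _ _ => rfl) hb
    (fun n hn => by
      rw [Nat.div_eq_of_lt hn, Nat.le_zero.1 (quotFn_le 0 _)]
      exact h.zero _ h2 (by decide) n)
  exact ⟨σ', _, by omega, r, h.insert fr fun n hn => hv n (by omega)⟩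

end Precomputation


/-! ### The whole precomputation and the final assembly -/

/-- The assignments before the first loop. -/
def startAsgs : List Stmt :=
  [.asg ⟨.isZero, .cst 0, .cst 1⟩, .asg ⟨.small, .cst 0, .cst 1⟩, .asg ⟨.endN, .size, .cst 1⟩,
    .asg ⟨.var, .cst 0, .cst 1⟩, .asg ⟨.var, .cst 1, .cst 1⟩, .asg ⟨.var, .cst 2, .cst 1⟩]

/-- The statements that determine the base and mark the ends of the loops. -/
def initStmts (m : ℕ) : List Stmt :=
  startAsgs ++ (tabulate .small .endN (.cst 1) (.cst 1) ++ (baseLoop m ++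
    [.asg ⟨.endQ, varE 2, .cst 1⟩, .asg ⟨.endP, varE 1, .cst 1⟩]))

theorem exists_runs_startAsgs {N M : ℕ} {I : ℕ → ℕ} (hM : (Env.mk N I fun _ _ => 0).Bd M) :
    ∃ σ, Runs N I M startAsgs (fun _ _ => 0) 6 σ ∧
      (∀ n, σ .isZero n = if n = 0 then 1 else 0) ∧ (∀ n, σ .small n = if n = 0 then 1 else 0) ∧
      (∀ n, σ .endN n = if n = N then 1 else 0) ∧ σ .var 0 = 1 ∧ σ .var 1 = 1 ∧ σ .var 2 = 1 ∧
      ∀ a, a ≠ .isZero → a ≠ .small → a ≠ .endN → a ≠ .var → ∀ n, σ a n = 0 := by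
  have h1 := hM.one_le
  have b1 := bd_assign hM .isZero 0 h1
  have b2 := bd_assign b1 .small 0 h1
  have b3 := bd_assign b2 .endN N h1
  have b4 := bd_assign b3 .var 0 h1
  have b5 := bd_assign b4 .var 1 h1
  have b6 := bd_assign b5 .var 2 h1
  refine ⟨_, .asg hM (.asg b1 (.asg b2 (.asg b3 (.asg b4 (.asg b5 (.nil b6)))))), ?_⟩
  simp only [Asg.exec, Expr.eval_cst, Expr.eval_size, assign_apply]
  refine ⟨by simp, by simp, by simp, by simp, by simp, by simp, fun a h1 h2 h3 h4 n => ?_⟩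
  simp [h1, h2, h3, h4]

theorem exists_runs_initStmts {N M m c : ℕ} {I : ℕ → ℕ} (hm : 2 ≤ m) (hN : 0 < N)
    (hNM : 2 ^ m * N ≤ M) (hI : ∀ j, I j ≤ M) :
    ∃ K σ n, 2 ≤ K ∧ N < K ^ m ∧ K ^ m ≤ 2 ^ m * N ∧ n ≤ 12 * M ∧
      Runs N I M (initStmts m) (fun _ _ => 0) n σ ∧ Inv K m c auxArrs σ := by
  have h2m : 1 ≤ 2 ^ m := Nat.one_le_two_pow
  have hNM' : N ≤ M := (Nat.le_mul_of_pos_left _ h2m).trans hNM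
  have hM0 : (Env.mk N I fun _ _ => 0).Bd M := ⟨by omega, hNM', hI, fun _ _ => Nat.zero_le _⟩
  have h1M := hM0.one_le
  obtain ⟨σ₁, r₁, z₁, s₁, n₁, v0, v1, v2, o₁⟩ := exists_runs_startAsgs hM0
  obtain ⟨σ₂, r₂, fr₂, t₂, t₂'⟩ := runs_tabulate (N := N) (I := I) (M := M) (T := .small)
    (Z := .endN) (st := .cst 1) (ev := .cst 1) (e := N) (s := 1) (f := fun _ => 1) (σ := σ₁)
    (by decide) (by decide) (by decide) (by decide) (by simp [z₁]) (by simp [z₁])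
    (fun n hn => by rw [n₁, if_neg hn.ne]) (by simp [n₁]) (fun _ _ => h1M) hNM'
    (fun _ _ _ _ _ _ => ⟨rfl, rfl⟩) r₁.bd_right
    (fun n hn => by rw [s₁, if_pos (by omega)])
  have hvar : σ₂ .var = σ₁ .var := fr₂ _ (by decide) (by decide)
  -- Beyond `N` the array was never written, and the zeros there answer the comparison with `N`.
  have hsmall : ∀ n, σ₂ .small n = if n ≤ N then 1 else 0 := fun n => by
    split_ifs with h
    · exact t₂ n (by omega)
    · rw [t₂' n (by omega), s₁, if_neg (by omega)]
  obtain ⟨σ₃, n, K, hn, r₃, hK, hNK, hKN, w0, w1, w2, fr₃⟩ := runs_baseLoop (m := m) (K := 1)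
    (by omega) hN hNM N r₂.bd_right hsmall le_rfl (by rw [hvar, v0]) (by rw [hvar, v1, one_pow])
    (by rw [hvar, v2, one_pow]) (by rw [one_pow]; exact Nat.mul_pos h2m hN) (by rw [one_pow])
  have b₃ := r₃.bd_right
  have b₄ := bd_assign b₃ .endQ (K ^ m) h1M
  have b₅ := bd_assign b₄ .endP (K ^ (m - 1)) h1M
  have e₄ : (Asg.mk .endQ (varE 2) (.cst 1)).exec N I σ₃ = assign σ₃ .endQ (K ^ m) 1 := by
    simp only [Asg.exec, varE, Expr.eval_get, Expr.eval_cst, w2]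
  have e₅ : (Asg.mk .endP (varE 1) (.cst 1)).exec N I (assign σ₃ .endQ (K ^ m) 1) =
      assign (assign σ₃ .endQ (K ^ m) 1) .endP (K ^ (m - 1)) 1 := by
    simp only [Asg.exec, varE, Expr.eval_get, Expr.eval_cst, assign_of_ne (show Arr.var ≠ .endQ by
      decide), w1]
  have r₅ : Runs N I M [.asg ⟨.endQ, varE 2, .cst 1⟩, .asg ⟨.endP, varE 1, .cst 1⟩] σ₃ 2
      (assign (assign σ₃ .endQ (K ^ m) 1) .endP (K ^ (m - 1)) 1) := by
    refine .asg b₃ ?_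
    rw [e₄]
    refine .asg b₄ ?_
    rw [e₅]
    exact .nil b₅
  have hfr : ∀ a, a ≠ .small → a ≠ .ctr → a ≠ .var → σ₃ a = σ₁ a := fun a h1 h2 h3 =>
    (fr₃ a h3).trans (fr₂ a h1 h2)
  refine ⟨K, _, _, hK, hNK, hKN, ?_, r₁.append (r₂.append (r₃.append r₅)), ?_, ?_⟩
  · omega
  · intro a ha
    simp only [auxArrs, Finset.mem_insert, Finset.mem_singleton] at ha
    rcases ha with rfl | rfl | rfl | rfl | rfl | rfl
    · rw [assign_of_ne (by decide), assign_of_ne (by decide),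
        hfr _ (by decide) (by decide) (by decide)]
      exact ⟨by simp [z₁], by simp [z₁]⟩
    · trivial
    · trivial
    · rw [assign_of_ne (by decide), assign_of_ne (by decide)]
      exact ⟨w0, w1, w2⟩
    · rw [assign_of_ne (by decide)]
      have h0 : ∀ n, σ₃ .endQ n = 0 := fun n => by
        rw [hfr _ (by decide) (by decide) (by decide)]
        exact o₁ _ (by decide) (by decide) (by decide) (by decide) n
      exact ⟨fun n hn => by simp [assign_apply, hn.ne, h0], by simp [assign_apply]⟩
    · have h0 : ∀ n, σ₃ .endP n = 0 := fun n => by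
        rw [hfr _ (by decide) (by decide) (by decide)]
        exact o₁ _ (by decide) (by decide) (by decide) (by decide) n
      exact ⟨fun n hn => by simp [assign_apply, hn.ne, h0], by simp [assign_apply]⟩
  · intro a ha hac n
    simp only [auxArrs, Finset.mem_insert, Finset.mem_singleton, not_or] at ha
    obtain ⟨h1, h2, h3, h4, h5, h6⟩ := ha
    rw [assign_of_ne h6, assign_of_ne h5, hfr a h2 hac h4]
    exact o₁ a h1 h2 h3 h4 n

/-- The statements of the precomputation. -/
def preStmts (c m : ℕ) : List Stmt :=
  initStmts m ++ (divStmts ++ (modStmts ++ (scaleStmts ++ (predStmts ++ (compStmts ++ (mulStmts ++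
    (rootStmts c m ++ quotStmts m)))))))

theorem exists_runs_preStmts {N M m c : ℕ} {I : ℕ → ℕ} (hc : 2 ≤ c) (hm : 2 ≤ m) (hN : 0 < N)
    (hNM : 2 * (2 ^ m * N) ≤ M) (hI : ∀ j, I j ≤ M) :
    ∃ K σ n, N < K ^ m ∧ n ≤ 60 * M ∧ Runs N I M (preStmts c m) (fun _ _ => 0) n σ ∧
      ∀ J, Full ⟨N, J, σ⟩ K (K ^ m) c := by
  obtain ⟨K, σ₀, n₀, hK, hNK, hKN, hn₀, r₀, i₀⟩ :=
    exists_runs_initStmts (c := c) (I := I) (M := M) hm hN (by omega) hI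
  have hM : 2 * K ^ m ≤ M := by omega
  obtain ⟨σ₁, n₁, hn₁, r₁, i₁⟩ := fills_div (I := I) hK hm hM (by decide) (by decide) _ i₀
    r₀.bd_right
  obtain ⟨σ₂, n₂, hn₂, r₂, i₂⟩ := fills_mod (I := I) hK hm hM (by decide) (by decide) _ i₁
    r₁.bd_right
  obtain ⟨σ₃, n₃, hn₃, r₃, i₃⟩ := fills_scale (I := I) hK hm hM (by decide) (by decide) _ i₂
    r₂.bd_right
  obtain ⟨σ₄, n₄, hn₄, r₄, i₄⟩ := fills_pred (I := I) hK hm hM (by decide) (by decide) _ i₃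
    r₃.bd_right
  obtain ⟨σ₅, n₅, hn₅, r₅, i₅⟩ := fills_comp (I := I) hK hm hM (by decide) (by decide) (by decide)
    _ i₄ r₄.bd_right
  obtain ⟨σ₆, n₆, hn₆, r₆, i₆⟩ := fills_mul (I := I) hK hm hM (by decide) (by decide) (by decide)
    _ i₅ r₅.bd_right
  obtain ⟨σ₇, n₇, hn₇, r₇, i₇⟩ := fills_root (I := I) hK hm hM hc (by decide) (by decide)
    _ i₆ r₆.bd_right
  obtain ⟨σ₈, n₈, hn₈, r₈, i₈⟩ := fills_quot (I := I) hK hm hM (by decide) (by decide)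
    _ i₇ r₇.bd_right
  refine ⟨K, σ₈, _, hNK, ?_, r₀.append (r₁.append (r₂.append (r₃.append (r₄.append (r₅.append
    (r₆.append (r₇.append r₈))))))), fun J => ⟨basic_of_good hK hm fun a ha => i₈.good a ?_,
      i₈.good .quot (by decide), i₈.good .root (by decide)⟩⟩
  -- At most `12 * M` steps for the initialization and `6 * M` for each of the eight tables.
  · omega
  · revert a
    decide

theorem exists_forall_mem_le {α : Type*} (l : List α) (f : α → ℕ) : ∃ b, ∀ x ∈ l, f x ≤ b :=
  ⟨(l.map f).sum, fun _ hx => List.single_le_sum (fun _ _ => Nat.zero_le _) _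
    (List.mem_map_of_mem hx)⟩

end AdditionRAM

/-- Constant-time computation of `c`-th roots of integers below `N ^ d` by a RAM with addition, after
a linear-time precomputation. The precomputation `pre` gets only `N`; `query` starts with the memory
that `pre` has left, reads the `d` base-`N` digits of `x` in its input registers and outputs the `d`
base-`N` digits of the root. The constants `k`, `T`, `b` and the programs depend on `c` and `d` only;
all registers contain integers at most `b * N`. -/
theorem mainTheorem5 (c d : ℕ) (hc : 2 ≤ c) (hd : 1 ≤ d) :
    ∃ (pre query : AdditionRAM.Program) (k T b : ℕ), ∀ N : ℕ, 0 < N →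
      ∃ (t : ℕ) (C : AdditionRAM.Config), t ≤ k * N ∧
        pre.RunsTo N (fun _ => 0) (AdditionRAM.Config.start fun _ => 0) t (b * N) C ∧
        ∀ x : ℕ, x < N ^ d →
          ∃ (t' : ℕ) (C' : AdditionRAM.Config), t' ≤ T ∧
            query.RunsTo N (AdditionRAM.digit N x) (AdditionRAM.Config.start C.mem)
              t' (b * N) C' ∧
            C'.out = AdditionRAM.digitList N d ⌊(x : ℝ) ^ (1 / (c : ℝ))⌋₊ := by
  open AdditionRAM in
  obtain ⟨T₀, hT₀⟩ := exists_forall_mem_le (preStmts c (digitsN c)) Stmt.len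
  obtain ⟨w, hw⟩ := exists_forall_mem_le (preStmts c (digitsN c)) Stmt.weight
  obtain ⟨w', hw'⟩ := exists_forall_mem_le (queryExprs c d) fun e => e.weight 0
  refine ⟨stmtsProgram (preStmts c (digitsN c)), outProgram (queryExprs c d),
    60 * (2 * 2 ^ digitsN c) * T₀, (outCode (queryExprs c d)).length,
    (w + w') * (2 * 2 ^ digitsN c), fun N hN => ?_⟩
  obtain ⟨K, σ, n, hNK, hn, hruns, hfull⟩ := exists_runs_preStmts (N := N)
    (M := 2 * (2 ^ digitsN c * N)) (m := digitsN c) (I := fun _ => 0) hc (by simp [digitsN]) hN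
    le_rfl (fun _ => Nat.zero_le _)
  obtain ⟨t, C, ht, hrun, hholds⟩ := hruns.runsTo (W := (w + w') * (2 * 2 ^ digitsN c) * N) hT₀ hw
    (by
      calc w * (2 * (2 ^ digitsN c * N)) = w * (2 * 2 ^ digitsN c) * N := by ring
        _ ≤ _ := Nat.mul_le_mul_right _ (Nat.mul_le_mul_right _ (Nat.le_add_right _ _)))
  refine ⟨t, C, ?_, hrun, fun x hx => ?_⟩
  · calc t ≤ n * T₀ := ht
      _ ≤ 60 * (2 * (2 ^ digitsN c * N)) * T₀ := Nat.mul_le_mul_right _ hn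
      _ = _ := by ring
  -- The query starts with all registers left by the precomputation, temporaries included, so their
  -- bound is read off its final configuration.
  · have hmem := (hrun.2.2.2 t le_rfl).2.2
    rw [hrun.1] at hmem
    have hb := hruns.bd_right
    -- The input registers now contain digits of `x`, which are below `N`, so the same bound
    -- persists.
    have hb' : (Env.mk N (digit N x) σ).Bd (2 * (2 ^ digitsN c * N)) :=
      ⟨hb.1, hb.2, fun j => (digit_lt hN x j).le.trans hb.2, hb.4⟩
    obtain ⟨C', hC', hout⟩ := outProgram_runsTo hb' (queryExprs c d) hmem hholds (fun e he => by
      calc e.weight 0 * (2 * (2 ^ digitsN c * N)) ≤ w' * (2 * (2 ^ digitsN c * N)) :=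
            Nat.mul_le_mul_right _ (hw' e he)
        _ = w' * (2 * 2 ^ digitsN c) * N := by ring
        _ ≤ _ := Nat.mul_le_mul_right _ (Nat.mul_le_mul_right _ (Nat.le_add_left _ _)))
    refine ⟨_, C', le_rfl, hC', ?_⟩
    rw [hout, iroot_eq_floor_rpow (by omega)]
    exact (hfull (digit N x)).map_eval_queryExprs hc hN hNK rfl hx
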